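/- Let $G$ be a finite connected undirected graph, with multiple edges allowed but no self-loops, and let $G$ be equipped with a ribbon structure, i.e. a cyclic ordering of the edges incident to each vertex. Let $\mathrm{Div}^0(G)$ be the group of integer-valued functions on $V(G)$ (written $\sum_v n_v v$) with $\sum_v n_v=0$, let $\Delta$ be the graph Laplacian (degrees on the diagonal, $\Delta_{vw}=-\#\{\text{edges joining } v \text{ and } w\}$ for $v\ne w$), and let $\mathrm{Pic}^0(G)=\mathrm{Div}^0(G)/\operatorname{im}\Delta$ be the sandpile group. Let $\mathcal T(G)$ be the set of spanning trees of $G$. For vertices $r,x$ and $T\in\mathcal T(G)$, orient the edges of $T$ towards $r$, so that every vertex $v\neq r$ carries a rotor, namely the edge of $T$ leaving $v$. Place a chip at $x$ and, as long as the chip is not at $r$, repeat the following step: advance the rotor at the chip's current position to the next edge in the cyclic order there, and move the chip along this new edge. The process stops when the chip first reaches $r$ (at once if $x=r$), and then the rotors form a spanning tree $T'$ oriented towards $r$. For each $r$ there is a unique action of $\mathrm{Pic}^0(G)$ on $\mathcal T(G)$ in which, for every vertex $x$ and every $T$, the class of $x-r$ sends $T$ to this $T'$; it is called the rotor-routing action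 with basepoint $r$. The rotor-routing action of $\mathrm{Pic}^0(G)$ on $\mathcal T(G)$ is the same for all basepoints $r\in V(G)$ if and only if $G$ is planar. Here $G$ is planar if every cycle is separating, in the following sense. Let $C$ be an oriented cycle (without repeated vertices or edges; two parallel edges form a cycle of length $2$). At a vertex of $C$, an edge is on the right of $C$ if it comes after the out-edge and before the in-edge of $C$ in the cyclic order, and on the left of $C$ if it comes after the in-edge and before the out-edge. The cycle $C$ is separating if there is no path (of length at least one, without repeated edges, possibly closed) whose endpoints lie on $C$, whose other vertices do not lie on $C$, whose first edge is on the left of $C$ and whose last edge is on the right of $C$. -/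

import Mathlib

open scoped Graph

namespace Graph

noncomputable section

/-- The vertices `u` and `v` are joined by a walk all of whose edges lie in `T`. -/
def ReachesIn {α β : Type*} (G : Graph α β) (T : Set β) (u v : V(G)) : Prop :=
  Relation.ReflTransGen (fun a b : V(G) => ∃ e ∈ T, G.IsLink e a b) u v

/-- A multigraph is connected if it has a vertex and any two vertices are joined by a walk. -/
def IsConnected {α β : Type*} (G : Graph α β) : Prop :=
  V(G).Nonempty ∧ ∀ u v : V(G), G.ReachesIn E(G) u v

/-- An oriented cycle in a multigraph: a vertex-injective and edge-injective map from the cycle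
with `length` edges (vertices and edges indexed by `ZMod length`). The edge `edge i` is traversed
from `vert i` to `vert (i + 1)`. In a loopless graph the length is automatically at least two. -/
structure OrientedCycle {α β : Type*} (G : Graph α β) where
  /-- the number of edges -/
  length : ℕ
  length_pos : 0 < length
  /-- the vertices, in cyclic order -/
  vert : ZMod length → V(G)
  /-- the edges, in cyclic order -/
  edge : ZMod length → β
  isLink : ∀ i, G.IsLink (edge i) (vert i) (vert (i + 1))
  vert_injective : Function.Injective vert
  edge_injective : Function.Injective edge

/-- A set of edges is (the edge set of) a spanning tree if it connects all the vertices and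
contains no cycle. -/
structure IsSpanningTree {α β : Type*} (G : Graph α β) (T : Set β) : Prop where
  subset : T ⊆ E(G)
  connected : ∀ u v : V(G), G.ReachesIn T u v
  acyclic : ¬ ∃ C : G.OrientedCycle, ∀ i, C.edge i ∈ T

/-- The set `𝒯(G)` of spanning trees of `G`. -/
def SpanningTree {α β : Type*} (G : Graph α β) : Type _ := {T : Set β // G.IsSpanningTree T}

/-! ### The sandpile group -/

/-- The group `Div⁰(G)` of divisors of degree `0` (a divisor is an integer-valued function on the
finite set of vertices). -/
def divZero {α β : Type*} (G : Graph α β) [Fintype V(G)] : AddSubgroup (V(G) → ℤ) where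
  carrier := {D | ∑ v, D v = 0}
  zero_mem' := by simp
  add_mem' := by
    intro a b ha hb
    simp only [Set.mem_ofPred_eq, Pi.add_apply, Finset.sum_add_distrib] at *
    rw [ha, hb, add_zero]
  neg_mem' := by
    intro a ha
    simp only [Set.mem_ofPred_eq, Pi.neg_apply, Finset.sum_neg_distrib] at *
    rw [ha, neg_zero]

open Classical in
/-- The Laplacian matrix of a loopless multigraph: degrees on the diagonal, and minus the number of
edges joining `v` and `w` off the diagonal. -/
def laplacian {α β : Type*} (G : Graph α β) : Matrix V(G) V(G) ℤ :=
  Matrix.of fun v w =>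
    if v = w then ((G.incidenceSet v).ncard : ℤ) else -({e | G.IsLink e v w}.ncard : ℤ)

/-- The subgroup `im Δ` of the group of divisors. -/
def principalDivisors {α β : Type*} (G : Graph α β) [Fintype V(G)] : AddSubgroup (V(G) → ℤ) :=
  (LinearMap.range G.laplacian.mulVecLin).toAddSubgroup

/-- The sandpile group `Pic⁰(G) = Div⁰(G) / im Δ`. -/
abbrev PicZero {α β : Type*} (G : Graph α β) [Fintype V(G)] : Type _ :=
  G.divZero ⧸ G.principalDivisors.addSubgroupOf G.divZero

open Classical in
/-- The divisor `x - r` of degree zero. -/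
def divSub {α β : Type*} (G : Graph α β) [Fintype V(G)] (x r : V(G)) : G.divZero :=
  ⟨Pi.single x 1 - Pi.single r 1, by
    change ∑ v, (Pi.single x (1 : ℤ) - Pi.single r 1 : V(G) → ℤ) v = 0
    simp [Finset.sum_sub_distrib]⟩

/-- The class of the divisor `x - r` in the sandpile group. -/
def picSub {α β : Type*} (G : Graph α β) [Fintype V(G)] (x r : V(G)) : G.PicZero :=
  QuotientAddGroup.mk (G.divSub x r)

/-! ### Ribbon graphs and rotor-routing -/

/-- A ribbon structure: a cyclic ordering of the edges incident to each vertex. The edge following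
`e` in the cyclic order at `v` is `next v e`. (The values of `next v` at edges that
are not incident to `v` play no role.) -/
structure RibbonStructure {α β : Type*} (G : Graph α β) where
  /-- the successor in the cyclic order at a vertex -/
  next : V(G) → Equiv.Perm β
  isCycleOn : ∀ v : V(G), (next v).IsCycleOn (G.incidenceSet v)

/-- A choice of an edge (the rotor) at every vertex other than the root `r`. In a loopless
graph an edge incident to `v` is the same as a directed edge based at `v`. -/
abbrev Rotors {α β : Type*} (G : Graph α β) (r : V(G)) : Type _ := {v : V(G) // v ≠ r} → β

/-- The rotors `ρ` are the edges of `T`, each directed towards the root `r`: the rotor at `v` is an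
edge incident to `v`, the rotors are exactly the edges of `T`, and from every vertex one arrives at
`r` by following the rotors. -/
structure IsOrientedTowards {α β : Type*} (G : Graph α β) (r : V(G)) (T : Set β)
    (ρ : G.Rotors r) : Prop where
  inc : ∀ v : {v : V(G) // v ≠ r}, G.Inc (ρ v) v.1
  range_eq : Set.range ρ = T
  towards : ∀ v : V(G), Relation.ReflTransGen
    (fun a b : V(G) => ∃ h : a ≠ r, G.IsLink (ρ ⟨a, h⟩) a b) v r

namespace RibbonStructure

open Classical in
/-- One step of the rotor-routing process with sink `r`: the rotor at the position `x ≠ r` of the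
chip advances to the next edge in the cyclic order at `x`, and the chip moves along this edge. There
is no step from `r`: the process stops when the chip first reaches `r`. -/
def RotorStep {α β : Type*} {G : Graph α β} (R : G.RibbonStructure) (r : V(G))
    (s t : G.Rotors r × V(G)) : Prop :=
  ∃ h : s.2 ≠ r,
    t.1 = Function.update s.1 ⟨s.2, h⟩ (R.next s.2 (s.1 ⟨s.2, h⟩)) ∧
    G.IsLink (t.1 ⟨s.2, h⟩) s.2 t.2

/-- Orienting `T` towards `r`, placing a chip at `x` and running the rotor-routing process until the
chip first reaches `r` gives the tree `T'` oriented towards `r`. -/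
def RoutesTo {α β : Type*} {G : Graph α β} (R : G.RibbonStructure) (r x : V(G))
    (T T' : G.SpanningTree) : Prop :=
  ∃ ρ σ : G.Rotors r, G.IsOrientedTowards r T.1 ρ ∧ G.IsOrientedTowards r T'.1 σ ∧
    Relation.ReflTransGen (R.RotorStep r) (ρ, x) (σ, r)

/-- The action `φ` of the sandpile group on the set of spanning trees is the rotor-routing action
with basepoint `r`: for every vertex `x`, the class of `x - r` maps each spanning tree `T` to the
tree obtained from `T` by routing a chip from `x` to `r`. -/
def IsRotorRoutingAction {α β : Type*} {G : Graph α β} [Fintype V(G)] (R : G.RibbonStructure)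
    (r : V(G)) (φ : Multiplicative G.PicZero →* Equiv.Perm G.SpanningTree) : Prop :=
  ∀ (x : V(G)) (T : G.SpanningTree),
    R.RoutesTo r x T (φ (Multiplicative.ofAdd (G.picSub x r)) T)

/-! ### Planarity -/

/-- In the cyclic order at `v`, the edge `f` comes after `a` and before `b`. -/
def IsBetween {α β : Type*} {G : Graph α β} (R : G.RibbonStructure) (v : V(G)) (a f b : β) : Prop :=
  ∃ m : ℕ, 0 < m ∧ f = (R.next v ^ m) a ∧ ∀ j : ℕ, 0 < j → j ≤ m → (R.next v ^ j) a ≠ b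

/-- The edge `f` is on the right of `C` at the vertex `C.vert i`: it comes after the out-edge and
before the in-edge of `C`. -/
def IsRightOf {α β : Type*} {G : Graph α β} (R : G.RibbonStructure) (C : G.OrientedCycle)
    (i : ZMod C.length) (f : β) : Prop :=
  R.IsBetween (C.vert i) (C.edge i) f (C.edge (i - 1))

/-- The edge `f` is on the left of `C` at the vertex `C.vert i`: it comes after the in-edge and
before the out-edge of `C`. -/
def IsLeftOf {α β : Type*} {G : Graph α β} (R : G.RibbonStructure) (C : G.OrientedCycle)
    (i : ZMod C.length) (f : β) : Prop :=
  R.IsBetween (C.vert i) (C.edge (i - 1)) f (C.edge i)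

/-- The cycle `C` is nonseparating: there is a path, given by its vertices `p 0, …, p (k + 1)` and
its pairwise distinct edges `f 0, …, f k`, whose endpoints lie on `C`, which is disjoint from `C`
otherwise, whose first edge is on the left of `C` and whose last edge is on the right of `C`. -/
def IsNonseparating {α β : Type*} {G : Graph α β} (R : G.RibbonStructure)
    (C : G.OrientedCycle) : Prop :=
  ∃ (k : ℕ) (p : ℕ → V(G)) (f : ℕ → β) (i j : ZMod C.length),
    (∀ n ≤ k, G.IsLink (f n) (p n) (p (n + 1))) ∧
    Set.InjOn f (Set.Iic k) ∧
    p 0 = C.vert i ∧ p (k + 1) = C.vert j ∧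
    (∀ n, 0 < n → n ≤ k → p n ∉ Set.range C.vert) ∧
    R.IsLeftOf C i (f 0) ∧ R.IsRightOf C j (f k)

/-- A ribbon graph is planar if every cycle is separating. -/
def IsPlanar {α β : Type*} {G : Graph α β} (R : G.RibbonStructure) : Prop :=
  ∀ C : G.OrientedCycle, ¬ R.IsNonseparating C

end RibbonStructure

end

end Graph

/-! A run of the rotor-router is recorded by a flow: `c v e` counts the departures from `v` along
`e`. Since a rotor uses consecutive edges, the jumps of `c v` around the cyclic order at `v` are the
indicator of the initial rotor minus that of the final one, while the net outflow of `c` is the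
initial minus the final divisor. `Turns J D` says that some integer flow has jumps `J` and net
outflow `D`. This relation is additive, and flows without jumps realize the principal divisors. At
basepoint `r`, the class of `D` sends `T` to `T'` exactly when `Turns` relates `rotorInd (T.rotors
r) - rotorInd (T'.rotors r)` to `D` (`turns_route`, `Turns.route_eq`). Uniqueness of `T'` is a
maximum principle for conservative flows (`card_max_darts`, `Turns.rotors_eq`); existence comes from
termination of the process (`not_infinite_run`).

Changing the basepoint alters the rotors of a tree only along the tree path between the two
basepoints. Comparing two trees, the discrepancy between the actions is therefore carried by cycles:
the actions agree for all basepoints if and only if each cycle `C` is reversible, that is, `Turns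
C.turn 0` (`routingAction_eq_of_isReversible`, `isReversible_of_routingAction_eq`).

It remains to compare reversible with separating. If `C` separates, a unit flow on every dart out of
its left side, completed on `C` by the left edges and the out-edges, is conservative and has the
right jumps (`isReversible_of_not_isNonseparating`). Conversely, a conservative flow with jumps
`C.turn` is maximal exactly at the out-edges and left edges along `C`, and constant at each vertex
off `C` (`exists_flow`). Maximality propagates along a path leaving `C` on the left, which prevents
the path from returning on the right if it has an interior vertex (`not_crossing`). A single chord
is not excluded by `C` alone. If one of the two arcs it cuts off has an interior vertex, that arc
crosses the cycle made of the chord and the other arc (`not_chord_of_two_le`). Otherwise there are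
three parallel edges with the same cyclic order at both ends, and counting maximal darts yields a
tighter such triple, so an infinite descent applies (`not_isBetween_both_ends`). -/

namespace Graph

noncomputable section

variable {α β : Type*} {G : Graph α β}

/-! ### Darts: a dart is an edge together with one of its ends -/

lemma IsLink.vert_eq_or {e : β} {a b c d : V(G)} (h : G.IsLink e a b) (h' : G.IsLink e c d) :
    (a = c ∧ b = d) ∨ (a = d ∧ b = c) := by
  rcases h.eq_and_eq_or_eq_and_eq h' with ⟨h1, h2⟩ | ⟨h1, h2⟩
  · exact .inl ⟨Subtype.ext h1, Subtype.ext h2⟩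
  · exact .inr ⟨Subtype.ext h1, Subtype.ext h2⟩

lemma IsLink.vert_right_unique {e : β} {a b c : V(G)} (h : G.IsLink e a b) (h' : G.IsLink e a c) :
    b = c :=
  Subtype.ext (h.right_unique h')

lemma IsLink.vert_ne [G.Loopless] {e : β} {a b : V(G)} (h : G.IsLink e a b) : a ≠ b :=
  fun hab => h.ne (congrArg Subtype.val hab)

lemma Inc.exists_isLink {e : β} {v : V(G)} (h : G.Inc e v) : ∃ w : V(G), G.IsLink e v w := by
  obtain ⟨w, hw⟩ := h
  exact ⟨⟨w, hw.right_mem⟩, hw⟩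

lemma ReachesIn.symm {T : Set β} {a b : V(G)} (h : G.ReachesIn T a b) : G.ReachesIn T b a := by
  induction h with
  | refl => exact .refl
  | tail _ h2 ih =>
    obtain ⟨e, he, hl⟩ := h2
    exact Relation.ReflTransGen.head ⟨e, he, hl.symm⟩ ih

open Classical in
/-- The other end of the edge `e` at `v`. -/
def tgt (G : Graph α β) (v : V(G)) (e : β) : V(G) :=
  if h : ∃ w : V(G), G.IsLink e v w then h.choose else v

lemma Inc.isLink_tgt {e : β} {v : V(G)} (h : G.Inc e v) : G.IsLink e v (G.tgt v e) := by
  rw [tgt, dif_pos h.exists_isLink]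
  exact h.exists_isLink.choose_spec

lemma IsLink.tgt_eq {e : β} {v w : V(G)} (h : G.IsLink e v w) : G.tgt v e = w :=
  h.inc_left.isLink_tgt.vert_right_unique h

lemma finite_incidenceSet [Finite E(G)] (v : V(G)) : (G.incidenceSet v).Finite :=
  (Set.toFinite E(G)).subset (G.incidenceSet_subset_edgeSet v)

/-- The finite set of edges at `v`. -/
def incFinset (G : Graph α β) [Finite E(G)] (v : V(G)) : Finset β :=
  (finite_incidenceSet v).toFinset

lemma mem_incFinset [Finite E(G)] {v : V(G)} {e : β} : e ∈ G.incFinset v ↔ G.Inc e v := by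
  simp [incFinset]

/-- Reversal `(v, e) ↦ (G.tgt v e, e)` is an involution on darts, so total inflow equals total
outflow. -/
lemma sum_darts_swap [Fintype V(G)] [Finite E(G)] (g : V(G) → β → ℤ) :
    ∑ v, ∑ e ∈ G.incFinset v, g (G.tgt v e) e = ∑ v, ∑ e ∈ G.incFinset v, g v e := by
  rw [Finset.sum_sigma', Finset.sum_sigma']
  refine Finset.sum_bij' (fun x _ => ⟨G.tgt x.1 x.2, x.2⟩) (fun x _ => ⟨G.tgt x.1 x.2, x.2⟩)
    ?_ ?_ ?_ ?_ ?_
  all_goals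
    rintro ⟨v, e⟩ h
    simp only [Finset.mem_sigma, Finset.mem_univ, true_and, mem_incFinset] at h ⊢
  · exact h.isLink_tgt.inc_right
  · exact h.isLink_tgt.inc_right
  · rw [h.isLink_tgt.symm.tgt_eq]
  · rw [h.isLink_tgt.symm.tgt_eq]

/-- The net flow out of the vertices when `c v e` chips move along the edge `e` away from `v`. -/
def netFlow (G : Graph α β) [Finite E(G)] (c : V(G) → β → ℤ) (w : V(G)) : ℤ :=
  ∑ e ∈ G.incFinset w, (c w e - c (G.tgt w e) e)

open Classical in
/-- The indicator function of a dart. -/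
def dartInd (v : V(G)) (e : β) : V(G) → β → ℤ := fun w f => if w = v ∧ f = e then 1 else 0

lemma dartInd_apply_of_ne {v w : V(G)} {e f : β} (h : w ≠ v) : dartInd v e w f = 0 :=
  if_neg fun h' => h h'.1

/-! ### Net flow, the Laplacian, and maximal darts of conservative flows -/

section netFlow

variable [Finite E(G)]

lemma netFlow_add (c d : V(G) → β → ℤ) : G.netFlow (c + d) = G.netFlow c + G.netFlow d := by
  ext w
  simp only [netFlow, Pi.add_apply, ← Finset.sum_add_distrib]
  exact Finset.sum_congr rfl fun _ _ => by ring

lemma netFlow_neg (c : V(G) → β → ℤ) : G.netFlow (-c) = -G.netFlow c := by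
  ext w
  simp only [netFlow, Pi.neg_apply, ← Finset.sum_neg_distrib]
  exact Finset.sum_congr rfl fun _ _ => by ring

lemma netFlow_mem_divZero [Fintype V(G)] (c : V(G) → β → ℤ) : G.netFlow c ∈ G.divZero := by
  change ∑ w, G.netFlow c w = 0
  simp only [netFlow, Finset.sum_sub_distrib, sum_darts_swap, sub_self]

open Classical in
lemma netFlow_dartInd [Fintype V(G)] [G.Loopless] {v w : V(G)} {e : β} (h : G.IsLink e v w) :
    G.netFlow (dartInd v e) = Pi.single v 1 - Pi.single w 1 := by
  ext x
  have hvw := h.vert_ne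
  simp only [netFlow, dartInd, Pi.sub_apply, Pi.single_apply]
  by_cases hxv : x = v
  · subst hxv
    rw [Finset.sum_eq_single e]
    · simp [h.tgt_eq, hvw, hvw.symm]
    · intro f _ hf
      simp [hf]
    · intro h'
      exact absurd (mem_incFinset.2 h.inc_left) h'
  · by_cases hxw : x = w
    · subst hxw
      rw [Finset.sum_eq_single e]
      · simp [h.symm.tgt_eq, hxv]
      · intro f _ hf
        simp [hf]
      · intro h'
        exact absurd (mem_incFinset.2 h.inc_right) h'
    · rw [Finset.sum_eq_zero]
      · simp [hxv, hxw]
      · intro f hf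
        have hl := (mem_incFinset.1 hf).isLink_tgt
        by_cases hfe : f = e
        · subst hfe
          rcases h.vert_eq_or hl with ⟨h1, h2⟩ | ⟨h1, h2⟩
          · exact absurd h1.symm hxv
          · exact absurd h2.symm hxw
        · simp [hfe]

open Classical in
-- Firing `v` exactly `z v` times sends `z v` chips along each dart out of `v`. Grouping the edges
-- at `w` by their other end gives the matrix entries.
lemma laplacian_mulVec [Fintype V(G)] [G.Loopless] (z : V(G) → ℤ) :
    G.laplacian.mulVec z = G.netFlow fun v _ => z v := by
  ext w
  have h1 : ∑ e ∈ G.incFinset w, z (G.tgt w e) =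
      ∑ u, ∑ e ∈ G.incFinset w with G.tgt w e = u, z (G.tgt w e) :=
    (Finset.sum_fiberwise _ _ _).symm
  simp only [netFlow, Finset.sum_sub_distrib, h1, Matrix.mulVec, dotProduct, laplacian,
    Matrix.of_apply]
  have h2 : ∑ e ∈ G.incFinset w, z w = ∑ u, if w = u then ((G.incFinset w).card : ℤ) * z w else 0 := by
    simp
  rw [h2, ← Finset.sum_sub_distrib]
  refine Finset.sum_congr rfl fun u _ => ?_
  have h3 : ∑ e ∈ G.incFinset w with G.tgt w e = u, z (G.tgt w e) =
      ∑ e ∈ G.incFinset w with G.tgt w e = u, z u :=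
    Finset.sum_congr rfl fun e he => by rw [(Finset.mem_filter.1 he).2]
  have h4 : {e | G.IsLink e w u} = ((G.incFinset w).filter fun e => G.tgt w e = u : Set β) := by
    ext e
    simp only [Set.mem_ofPred_eq, Finset.coe_filter, mem_incFinset]
    exact ⟨fun h => ⟨h.inc_left, h.tgt_eq⟩, fun ⟨h, h'⟩ => h' ▸ h.isLink_tgt⟩
  rw [h3, Finset.sum_const, nsmul_eq_mul]
  by_cases hwu : w = u
  · subst hwu
    have h5 : {e ∈ G.incFinset w | G.tgt w e = w} = ∅ := by
      refine Finset.filter_eq_empty_iff.2 fun e he h => ?_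
      exact (mem_incFinset.1 he).isLink_tgt.vert_ne h.symm
    rw [h5, if_pos rfl, if_pos rfl, incFinset, ← Set.ncard_eq_toFinset_card _ (finite_incidenceSet w)]
    simp
  · rw [if_neg hwu, if_neg hwu, h4, Set.ncard_coe_finset]
    ring

/-- For a conservative flow whose values at the darts out of each vertex differ by at most one, as
many darts of maximal flow enter a vertex as leave it. -/
lemma card_max_darts [Fintype V(G)] {c : V(G) → β → ℤ} (h0 : G.netFlow c = 0) {M : ℤ}
    (hM : ∀ v, ∀ e ∈ G.incFinset v, c v e ≤ M)
    (hosc : ∀ v, ∀ e ∈ G.incFinset v, ∀ f ∈ G.incFinset v, c v e ≤ c v f + 1) (v : V(G)) :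
    ((G.incFinset v).filter fun e => c v e = M).card =
      ((G.incFinset v).filter fun e => c (G.tgt v e) e = M).card := by
  have hle : ∀ v ∈ Finset.univ, (((G.incFinset v).filter fun e => c v e = M).card : ℤ) ≤
      ((G.incFinset v).filter fun e => c (G.tgt v e) e = M).card := by
    intro v _
    by_cases hne : ((G.incFinset v).filter fun e => c v e = M).Nonempty
    · obtain ⟨e₀, he₀⟩ := hne
      obtain ⟨he₀, he₀M⟩ := Finset.mem_filter.1 he₀
      have hv : G.netFlow c v = 0 := congrFun h0 v
      have h1 : ∑ e ∈ G.incFinset v, c v e = ∑ e ∈ G.incFinset v, c (G.tgt v e) e := by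
        rw [netFlow, Finset.sum_sub_distrib] at hv
        linarith
      -- Since `e₀` attains `M` at `v`, all outgoing values are `M` or `M - 1`, so the outflow is
      -- determined by the count. The inflow is only bounded above by the analogous expression,
      -- which gives the inequality of counts; summing over all vertices turns it into an equality.
      have h2 : ∑ e ∈ G.incFinset v, c v e =
          ∑ e ∈ G.incFinset v, ((M - 1) + if c v e = M then 1 else 0) := by
        refine Finset.sum_congr rfl fun e he => ?_
        have := hM v e he
        have := hosc v e₀ he₀ e he
        split_ifs <;> omega
      have h3 : ∑ e ∈ G.incFinset v, c (G.tgt v e) e ≤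
          ∑ e ∈ G.incFinset v, ((M - 1) + if c (G.tgt v e) e = M then 1 else 0) := by
        refine Finset.sum_le_sum fun e he => ?_
        have := hM (G.tgt v e) e (mem_incFinset.2 (mem_incFinset.1 he).isLink_tgt.inc_right)
        split_ifs <;> omega
      rw [Finset.sum_add_distrib, ← Finset.sum_filter, Finset.sum_const, Finset.sum_const] at h2 h3
      simp only [nsmul_eq_mul, mul_one] at h2 h3
      linarith
    · rw [Finset.not_nonempty_iff_eq_empty.1 hne]
      simp
  have hsum : ∑ v, (((G.incFinset v).filter fun e => c v e = M).card : ℤ) =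
      ∑ v, (((G.incFinset v).filter fun e => c (G.tgt v e) e = M).card : ℤ) := by
    have := sum_darts_swap fun (v : V(G)) e => if c v e = M then 1 else 0
    simp only [← Finset.sum_filter, Finset.sum_const, nsmul_eq_mul, mul_one] at this
    exact this.symm
  exact_mod_cast (Finset.sum_eq_sum_iff_of_le hle).1 hsum v (Finset.mem_univ v)

/-- Darts of maximal flow lead to vertices from which darts of maximal flow depart. -/
lemma exists_max_dart_of_max_dart [Fintype V(G)] {c : V(G) → β → ℤ} (h0 : G.netFlow c = 0) {M : ℤ}
    (hM : ∀ v, ∀ e ∈ G.incFinset v, c v e ≤ M)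
    (hosc : ∀ v, ∀ e ∈ G.incFinset v, ∀ f ∈ G.incFinset v, c v e ≤ c v f + 1) {v w : V(G)} {e : β}
    (h : G.IsLink e v w) (he : c v e = M) : ∃ f, G.Inc f w ∧ c w f = M := by
  have h1 : e ∈ (G.incFinset w).filter fun e => c (G.tgt w e) e = M := by
    rw [Finset.mem_filter, mem_incFinset, h.symm.tgt_eq]
    exact ⟨h.inc_right, he⟩
  have h2 := Finset.card_pos.2 ⟨e, h1⟩
  rw [← card_max_darts h0 hM hosc w] at h2
  obtain ⟨f, hf⟩ := Finset.card_pos.1 h2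
  rw [Finset.mem_filter, mem_incFinset] at hf
  exact ⟨f, hf⟩

/-- If all darts out of a vertex have maximal flow, then so do all darts into it. -/
lemma max_dart_in_of_forall_max_dart_out [Fintype V(G)] {c : V(G) → β → ℤ}
    (h0 : G.netFlow c = 0) {M : ℤ} (hM : ∀ v, ∀ e ∈ G.incFinset v, c v e ≤ M)
    (hosc : ∀ v, ∀ e ∈ G.incFinset v, ∀ f ∈ G.incFinset v, c v e ≤ c v f + 1) {v w : V(G)} {e : β}
    (h : G.IsLink e v w) (hw : ∀ f, G.Inc f w → c w f = M) : c v e = M := by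
  have h1 : (G.incFinset w).filter (fun e => c w e = M) = G.incFinset w :=
    Finset.filter_true_of_mem fun f hf => hw f (mem_incFinset.1 hf)
  have h2 := card_max_darts h0 hM hosc w
  rw [h1] at h2
  have h3 := Finset.filter_card_eq h2.symm e (mem_incFinset.2 h.inc_right)
  rwa [h.symm.tgt_eq] at h3

end netFlow

/-! ### Turning the rotors -/

namespace RibbonStructure

variable (R : G.RibbonStructure)

lemma inc_next {R : G.RibbonStructure} {v : V(G)} {e : β} :
    G.Inc (R.next v e) v ↔ G.Inc e v :=
  (R.isCycleOn v).apply_mem_iff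

lemma inc_pow {R : G.RibbonStructure} {v : V(G)} {e : β} (he : G.Inc e v) (m : ℕ) :
    G.Inc ((R.next v ^ m) e) v := by
  induction m with
  | zero => exact he
  | succ m ih =>
    rw [pow_succ']
    exact inc_next.2 ih

lemma exists_pow_eq [Finite E(G)] {v : V(G)} {e f : β} (he : G.Inc e v) (hf : G.Inc f v) :
    ∃ m : ℕ, 0 < m ∧ (R.next v ^ m) e = f := by
  obtain ⟨n, hn⟩ := (R.isCycleOn v).exists_pow_eq' (finite_incidenceSet v)
    (show R.next v e ∈ G.incidenceSet v from inc_next.2 he) (show f ∈ G.incidenceSet v from hf)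
  exact ⟨n + 1, n.succ_pos, by rw [pow_succ]; exact hn⟩

/-- Finiteness lets forward steps alone go all the way round the cyclic order. -/
lemma inc_induction [Finite E(G)] {v : V(G)} {p : β → Prop} {e f : β} (he : G.Inc e v)
    (hf : G.Inc f v) (h0 : p e) (hs : ∀ g, G.Inc g v → p g → p (R.next v g)) : p f := by
  obtain ⟨m, -, rfl⟩ := R.exists_pow_eq he hf
  clear hf
  induction m with
  | zero => exact h0
  | succ m ih =>
    rw [pow_succ']
    exact hs _ (inc_pow he m) ih

/-- Moving chips by a flow `c` out of the rotors changes the rotors by `J` and the divisor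
by `D`. -/
def Turns [Finite E(G)] (J : V(G) → β → ℤ) (D : V(G) → ℤ) : Prop :=
  ∃ c : V(G) → β → ℤ, (∀ (v : V(G)) e, G.Inc e v → c v (R.next v e) - c v e = J v e) ∧ G.netFlow c = D

variable {R}

section Turns

variable [Finite E(G)]

lemma Turns.add {J K : V(G) → β → ℤ} {D E : V(G) → ℤ} (h : R.Turns J D) (h' : R.Turns K E) :
    R.Turns (J + K) (D + E) := by
  obtain ⟨c, hc, rfl⟩ := h
  obtain ⟨d, hd, rfl⟩ := h'
  refine ⟨c + d, fun v e he => ?_, netFlow_add c d⟩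
  simp only [Pi.add_apply, ← hc v e he, ← hd v e he]
  ring

lemma Turns.neg {J : V(G) → β → ℤ} {D : V(G) → ℤ} (h : R.Turns J D) : R.Turns (-J) (-D) := by
  obtain ⟨c, hc, rfl⟩ := h
  refine ⟨-c, fun v e he => ?_, netFlow_neg c⟩
  simp only [Pi.neg_apply, ← hc v e he]
  ring

lemma Turns.sub {J K : V(G) → β → ℤ} {D E : V(G) → ℤ} (h : R.Turns J D) (h' : R.Turns K E) :
    R.Turns (J - K) (D - E) := by
  rw [sub_eq_add_neg, sub_eq_add_neg]
  exact h.add h'.neg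

lemma Turns.zero : R.Turns 0 0 :=
  ⟨0, by simp, by ext; simp [netFlow]⟩

/-- Full turns leave every rotor where it was and amount to firing vertices. This is why the action
descends to the sandpile group. -/
lemma Turns.of_mem_principalDivisors [Fintype V(G)] [G.Loopless] {D : V(G) → ℤ}
    (h : D ∈ G.principalDivisors) : R.Turns 0 D := by
  obtain ⟨z, rfl⟩ := h
  exact ⟨fun v _ => z v, by simp, (laplacian_mulVec z).symm⟩

/-- The flow of one rotor-router step: the rotor leaves `e` and a single chip departs along the new
edge. -/
lemma Turns.next (v : V(G)) (e : β) :
    R.Turns (dartInd v e - dartInd v (R.next v e)) (G.netFlow (dartInd v (R.next v e))) := by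
  refine ⟨dartInd v (R.next v e), fun u f hf => ?_, rfl⟩
  by_cases hu : u = v
  · subst hu
    by_cases hfe : f = e
    · subst hfe
      simp [dartInd]
    · simp [dartInd, hfe]
  · simp [dartInd, hu]

lemma Turns.mem_divZero [Fintype V(G)] {J : V(G) → β → ℤ} {D : V(G) → ℤ} (h : R.Turns J D) :
    D ∈ G.divZero := by
  obtain ⟨c, -, rfl⟩ := h
  exact netFlow_mem_divZero c

end Turns

end RibbonStructure

/-! ### Paths and cycles -/

/-- The vertices `p 0, …, p n` and edges `f 0, …, f (n - 1)` form a path all of whose edges lie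
in `T`. -/
structure IsPathIn (G : Graph α β) (T : Set β) (n : ℕ) (p : ℕ → V(G)) (f : ℕ → β) : Prop where
  mem : ∀ k < n, f k ∈ T
  isLink : ∀ k < n, G.IsLink (f k) (p k) (p (k + 1))
  injOn : Set.InjOn p (Set.Iic n)

namespace IsPathIn

variable {T : Set β} {n : ℕ} {p : ℕ → V(G)} {f : ℕ → β}

lemma edge_injOn (h : G.IsPathIn T n p f) : Set.InjOn f (Set.Iio n) := by
  intro k hk l hl hkl
  simp only [Set.mem_Iio] at hk hl
  have h1 := h.isLink k hk
  rw [hkl] at h1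
  rcases h1.vert_eq_or (h.isLink l hl) with ⟨h2, -⟩ | ⟨h2, h3⟩
  · exact h.injOn (Set.mem_Iic.2 hk.le) (Set.mem_Iic.2 hl.le) h2
  · have := h.injOn (Set.mem_Iic.2 hk.le) (Set.mem_Iic.2 hl) h2
    have := h.injOn (Set.mem_Iic.2 hk) (Set.mem_Iic.2 hl.le) h3
    omega

lemma take {m : ℕ} (h : G.IsPathIn T n p f) (hm : m ≤ n) : G.IsPathIn T m p f :=
  ⟨fun k hk => h.mem k (hk.trans_le hm), fun k hk => h.isLink k (hk.trans_le hm),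
    h.injOn.mono (Set.Iic_subset_Iic.2 hm)⟩

open Classical in
lemma snoc {e : β} {c : V(G)} (h : G.IsPathIn T n p f) (he : e ∈ T) (hl : G.IsLink e (p n) c)
    (hc : ∀ k ≤ n, p k ≠ c) :
    G.IsPathIn T (n + 1) (fun m => if m ≤ n then p m else c) (fun m => if m < n then f m else e) := by
  refine ⟨fun k hk => ?_, fun k hk => ?_, fun k hk l hl hkl => ?_⟩
  · split_ifs with h'
    exacts [h.mem k h', he]
  · by_cases h' : k < n
    · rw [if_pos h', if_pos h'.le, if_pos (by omega)]
      exact h.isLink k h'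
    · obtain rfl : k = n := by omega
      simpa using hl
  · simp only [Set.mem_Iic] at hk hl
    split_ifs at hkl with h1 h2 h2
    · exact h.injOn h1 h2 hkl
    · exact absurd hkl (hc k h1)
    · exact absurd hkl.symm (hc l h2)
    · omega

end IsPathIn

/-- A walk contains a path. -/
lemma exists_isPathIn [Nonempty β] {T : Set β} {r : V(G) → V(G) → Prop}
    (hr : ∀ a b, r a b → ∃ e ∈ T, G.IsLink e a b) {a b : V(G)} (h : Relation.ReflTransGen r a b) :
    ∃ n p f, G.IsPathIn T n p f ∧ p 0 = a ∧ p n = b ∧ ∀ k < n, r (p k) (p (k + 1)) := by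
  induction h with
  | refl =>
    refine ⟨0, fun _ => a, fun _ => Classical.arbitrary β,
      ⟨by simp, by simp, fun k hk l hl _ => ?_⟩, rfl, rfl, by simp⟩
    simp only [Set.mem_Iic, Nat.le_zero] at hk hl
    rw [hk, hl]
  | @tail b c _ h2 ih =>
    obtain ⟨n, p, f, hp, rfl, rfl, hpr⟩ := ih
    by_cases hc : ∃ k ≤ n, p k = c
    · obtain ⟨k, hk, rfl⟩ := hc
      exact ⟨k, p, f, hp.take hk, rfl, rfl, fun l hl => hpr l (hl.trans_le hk)⟩
    · push Not at hc
      obtain ⟨e, he, hl⟩ := hr _ _ h2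
      refine ⟨n + 1, _, _, hp.snoc he hl hc, by simp, by simp, fun k hk => ?_⟩
      by_cases h' : k < n
      · simpa [h'.le, Nat.succ_le_iff.2 h'] using hpr k h'
      · obtain rfl : k = n := by omega
        simpa using h2

namespace OrientedCycle

instance (C : G.OrientedCycle) : NeZero C.length := ⟨C.length_pos.ne'⟩

lemma length_ne_one [G.Loopless] (C : G.OrientedCycle) : C.length ≠ 1 := by
  intro h
  have : Subsingleton (ZMod C.length) := by
    rw [h]
    exact inferInstanceAs (Subsingleton (Fin 1))
  exact (C.isLink 0).vert_ne (congrArg C.vert (Subsingleton.elim _ _))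

lemma add_one_ne [G.Loopless] (C : G.OrientedCycle) (i : ZMod C.length) : i + 1 ≠ i := by
  intro h
  have h1 : ((1 : ℕ) : ZMod C.length) = 0 := by
    rw [Nat.cast_one]
    exact add_eq_left.1 h
  rw [ZMod.natCast_eq_zero_iff, Nat.dvd_one] at h1
  exact C.length_ne_one h1

lemma in_ne_out [G.Loopless] (C : G.OrientedCycle) (i : ZMod C.length) :
    C.edge (i - 1) ≠ C.edge i := by
  intro h
  have h1 := C.edge_injective h
  exact C.add_one_ne (i - 1) (by rw [sub_add_cancel]; exact h1.symm)

lemma isLink_in (C : G.OrientedCycle) (i : ZMod C.length) :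
    G.IsLink (C.edge (i - 1)) (C.vert (i - 1)) (C.vert i) := by
  simpa using C.isLink (i - 1)

lemma inc_in (C : G.OrientedCycle) (i : ZMod C.length) : G.Inc (C.edge (i - 1)) (C.vert i) :=
  (C.isLink_in i).inc_right

lemma inc_out (C : G.OrientedCycle) (i : ZMod C.length) : G.Inc (C.edge i) (C.vert i) :=
  (C.isLink i).inc_left

lemma eq_or_eq_of_inc (C : G.OrientedCycle) {i j : ZMod C.length} (h : G.Inc (C.edge j) (C.vert i)) :
    j = i ∨ j = i - 1 := by
  obtain ⟨w, hw⟩ := h.exists_isLink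
  rcases hw.vert_eq_or (C.isLink j) with ⟨h1, -⟩ | ⟨h1, -⟩
  · exact .inl (C.vert_injective h1).symm
  · right
    rw [C.vert_injective h1, add_sub_cancel_right]

lemma natCast_injOn (C : G.OrientedCycle) {k l : ℕ} (hk : k < C.length) (hl : l < C.length)
    (h : (k : ZMod C.length) = l) : k = l := by
  rwa [ZMod.natCast_eq_natCast_iff', Nat.mod_eq_of_lt hk, Nat.mod_eq_of_lt hl] at h

lemma isPathIn (C : G.OrientedCycle) {T : Set β} {n : ℕ} (s : ZMod C.length) (hn : n < C.length)
    (hT : ∀ k < n, C.edge (s + k) ∈ T) :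
    G.IsPathIn T n (fun k => C.vert (s + k)) (fun k => C.edge (s + k)) := by
  refine ⟨hT, fun k _ => ?_, fun k hk l hl h => ?_⟩
  · have := C.isLink (s + k)
    simpa [add_assoc] using this
  · simp only [Set.mem_Iic] at hk hl
    exact C.natCast_injOn (by omega) (by omega) (add_left_cancel (C.vert_injective h))

/-- The cycle formed by a path and an edge joining its ends. -/
def ofPath {T : Set β} {n : ℕ} {p : ℕ → V(G)} {f : ℕ → β} (h : G.IsPathIn T n p f) (g : β)
    (hg : G.IsLink g (p n) (p 0)) (hgf : ∀ k < n, f k ≠ g) : G.OrientedCycle where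
  length := n + 1
  length_pos := n.succ_pos
  vert i := p i.val
  edge i := if i.val < n then f i.val else g
  isLink i := by
    have hi := ZMod.val_lt i
    by_cases h' : i.val < n
    · rw [if_pos h', ZMod.val_add_of_lt (by rw [ZMod.val_one'' (by omega)]; omega), ZMod.val_one'' (by omega)]
      exact h.isLink _ h'
    · have h2 : i.val = n := by omega
      have h3 : i + 1 = 0 := by
        rw [← ZMod.natCast_zmod_val i, h2]
        exact_mod_cast ZMod.natCast_self (n + 1)
      rw [if_neg h', h3, h2]
      simpa using hg
  vert_injective i j hij := by
    have hi := ZMod.val_lt i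
    have hj := ZMod.val_lt j
    exact ZMod.val_injective _ (h.injOn (Set.mem_Iic.2 (by omega)) (Set.mem_Iic.2 (by omega)) hij)
  edge_injective i j hij := by
    have hi := ZMod.val_lt i
    have hj := ZMod.val_lt j
    refine ZMod.val_injective _ ?_
    dsimp only at hij
    split_ifs at hij with h1 h2 h2
    · exact h.edge_injOn h1 h2 hij
    · exact absurd hij (hgf _ h1)
    · exact absurd hij.symm (hgf _ h2)
    · omega

section ofPath

variable {T : Set β} {n : ℕ} {p : ℕ → V(G)} {f : ℕ → β} (h : G.IsPathIn T n p f) (g : β)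
    (hg : G.IsLink g (p n) (p 0)) (hgf : ∀ k < n, f k ≠ g)

lemma ofPath_vert {k : ℕ} (hk : k ≤ n) :
    (ofPath h g hg hgf).vert (k : ZMod (ofPath h g hg hgf).length) = p k := by
  change p (ZMod.val (k : ZMod (n + 1))) = p k
  rw [ZMod.val_natCast_of_lt (by omega)]

lemma ofPath_edge {k : ℕ} (hk : k < n) :
    (ofPath h g hg hgf).edge (k : ZMod (ofPath h g hg hgf).length) = f k := by
  change (if ZMod.val (k : ZMod (n + 1)) < n then f (ZMod.val (k : ZMod (n + 1))) else g) = f k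
  rw [ZMod.val_natCast_of_lt (by omega), if_pos hk]

lemma ofPath_edge_last : (ofPath h g hg hgf).edge (n : ZMod (ofPath h g hg hgf).length) = g := by
  change (if ZMod.val (n : ZMod (n + 1)) < n then f (ZMod.val (n : ZMod (n + 1))) else g) = g
  rw [ZMod.val_natCast_of_lt (by omega), if_neg (lt_irrefl n)]

lemma ofPath_edge_zero_sub :
    (ofPath h g hg hgf).edge (((0 : ℕ) : ZMod (ofPath h g hg hgf).length) - 1) = g := by
  have h1 : ((0 : ℕ) : ZMod (ofPath h g hg hgf).length) = n + 1 := by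
    rw [← Nat.cast_succ, Nat.cast_zero]
    exact (ZMod.natCast_self (n + 1)).symm
  rw [h1, add_sub_cancel_right, ofPath_edge_last]

lemma ofPath_edge_succ_sub {k : ℕ} (hk : k < n) :
    (ofPath h g hg hgf).edge (((k + 1 : ℕ) : ZMod (ofPath h g hg hgf).length) - 1) = f k := by
  rw [Nat.cast_succ, add_sub_cancel_right, ofPath_edge h g hg hgf hk]

lemma exists_eq_of_mem_range_ofPath {v : V(G)} (hv : v ∈ Set.range (ofPath h g hg hgf).vert) :
    ∃ k ≤ n, v = p k := by
  obtain ⟨i, rfl⟩ := hv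
  have hi : ZMod.val (n := n + 1) i < n + 1 := ZMod.val_lt (n := n + 1) i
  exact ⟨ZMod.val (n := n + 1) i, by omega, rfl⟩

lemma ofPath_edge_mem {S : Set β} (hT : T ⊆ S) (hgS : g ∈ S) (i) :
    (ofPath h g hg hgf).edge i ∈ S := by
  change (if ZMod.val (n := n + 1) i < n then f (ZMod.val (n := n + 1) i) else g) ∈ S
  split_ifs with h'
  exacts [hT (h.mem _ h'), hgS]

end ofPath

/-- The difference of the indicator functions of the in-edges and the out-edges of a cycle. -/
def turn (C : G.OrientedCycle) : V(G) → β → ℤ :=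
  ∑ i, (dartInd (C.vert (i + 1)) (C.edge i) - dartInd (C.vert i) (C.edge i))

lemma turn_eq_sum_range (C : G.OrientedCycle) :
    C.turn = ∑ k ∈ Finset.range C.length,
      (dartInd (C.vert (k + 1)) (C.edge k) - dartInd (C.vert k) (C.edge k)) := by
  symm
  refine Finset.sum_bij' (fun k _ => (k : ZMod C.length)) (fun i _ => i.val) ?_ ?_ ?_ ?_ ?_
  · simp
  · intro i _
    exact Finset.mem_range.2 (ZMod.val_lt i)
  · intro k hk
    exact ZMod.val_natCast_of_lt (Finset.mem_range.1 hk)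
  · intro i _
    exact ZMod.natCast_zmod_val i
  · simp

lemma turn_ofPath {T : Set β} {n : ℕ} {p : ℕ → V(G)} {f : ℕ → β} (h : G.IsPathIn T n p f) (g : β)
    (hg : G.IsLink g (p n) (p 0)) (hgf : ∀ k < n, f k ≠ g) :
    (ofPath h g hg hgf).turn =
      ∑ k ∈ Finset.range n, (dartInd (p (k + 1)) (f k) - dartInd (p k) (f k)) +
        (dartInd (p 0) g - dartInd (p n) g) := by
  rw [turn_eq_sum_range]
  change ∑ k ∈ Finset.range (n + 1), _ = _
  rw [Finset.sum_range_succ]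
  congr 1
  · refine Finset.sum_congr rfl fun k hk => ?_
    have hk := Finset.mem_range.1 hk
    have h1 := ofPath_vert h g hg hgf (Nat.succ_le_of_lt hk)
    rw [Nat.cast_succ] at h1
    rw [ofPath_edge h g hg hgf hk, ofPath_vert h g hg hgf hk.le]
    congr 2
  · have h1 := ofPath_vert h g hg hgf (Nat.zero_le n)
    have h2 : ((n : ZMod (ofPath h g hg hgf).length) + 1) =
        ((0 : ℕ) : ZMod (ofPath h g hg hgf).length) := by
      rw [Nat.cast_zero]
      exact_mod_cast ZMod.natCast_self (n + 1)
    rw [← h2] at h1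
    rw [ofPath_edge_last h g hg hgf, ofPath_vert h g hg hgf le_rfl]
    congr 2

open Classical in
lemma turn_vert (C : G.OrientedCycle) (i : ZMod C.length) (e : β) :
    C.turn (C.vert i) e =
      (if e = C.edge (i - 1) then 1 else 0) - (if e = C.edge i then 1 else 0) := by
  simp only [turn, Finset.sum_apply, Pi.sub_apply, dartInd, Finset.sum_sub_distrib]
  congr 1
  · rw [Finset.sum_eq_single (i - 1)]
    · simp
    · intro j _ hj
      rw [if_neg]
      rintro ⟨h, -⟩
      exact hj (eq_sub_of_add_eq (C.vert_injective h).symm)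
    · simp
  · rw [Finset.sum_eq_single i]
    · simp
    · intro j _ hj
      rw [if_neg]
      rintro ⟨h, -⟩
      exact hj (C.vert_injective h).symm
    · simp

lemma turn_of_notMem (C : G.OrientedCycle) {v : V(G)} (hv : v ∉ Set.range C.vert) (e : β) :
    C.turn v e = 0 := by
  simp only [turn, Finset.sum_apply, Pi.sub_apply]
  refine Finset.sum_eq_zero fun i _ => ?_
  rw [dartInd_apply_of_ne, dartInd_apply_of_ne, sub_self]
  · rintro rfl
    exact hv ⟨_, rfl⟩
  · rintro rfl
    exact hv ⟨_, rfl⟩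

end OrientedCycle

/-! ### Spanning trees and their orientations -/

/-- Rotors leading to the root form a spanning tree. -/
lemma isSpanningTree_range {r : V(G)} {ρ : G.Rotors r} (hinc : ∀ v, G.Inc (ρ v) v.1)
    (ht : ∀ v : V(G), Relation.ReflTransGen
      (fun a b : V(G) => ∃ h : a ≠ r, G.IsLink (ρ ⟨a, h⟩) a b) v r) :
    G.IsSpanningTree (Set.range ρ) := by
  have hr : ∀ v : V(G), G.ReachesIn (Set.range ρ) v r := fun v =>
    Relation.ReflTransGen.mono (fun a b ⟨h, hl⟩ => ⟨_, ⟨_, rfl⟩, hl⟩) _ _ (ht v)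
  refine ⟨?_, fun u v => (hr u).trans (hr v).symm, ?_⟩
  · rintro _ ⟨v, rfl⟩
    exact (hinc v).edge_mem
  · rintro ⟨C, hC⟩
    choose w hw using hC
    have h1 : ∀ i, ∃ j, (w i).1 = C.vert j := by
      intro i
      obtain ⟨u, hu⟩ := (hinc (w i)).exists_isLink
      rw [hw i] at hu
      rcases hu.vert_eq_or (C.isLink i) with ⟨h, -⟩ | ⟨h, -⟩
      exacts [⟨_, h⟩, ⟨_, h⟩]
    choose j hj using h1
    -- Each edge of the cycle is the rotor of one of its own vertices. By injectivity and finiteness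
    -- every vertex of the cycle is hit, so following rotors from the cycle never leaves it.
    -- Reaching `r` then means that `r` itself carries a rotor, which is impossible.
    have hinj : Function.Injective j := by
      intro a b hab
      have : w a = w b := Subtype.ext (by rw [hj, hj, hab])
      exact C.edge_injective (by rw [← hw a, ← hw b, this])
    have hsurj := Finite.surjective_of_injective hinj
    have hmem : ∀ v, Relation.ReflTransGen
        (fun a b : V(G) => ∃ h : a ≠ r, G.IsLink (ρ ⟨a, h⟩) a b) (C.vert 0) v →
        v ∈ Set.range C.vert := by
      intro v hv
      induction hv with
      | refl => exact ⟨0, rfl⟩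
      | tail _ h ih =>
        obtain ⟨i, rfl⟩ := ih
        obtain ⟨k, rfl⟩ := hsurj i
        obtain ⟨h, hl⟩ := h
        have h2 : (⟨C.vert (j k), h⟩ : {v : V(G) // v ≠ r}) = w k := Subtype.ext (hj k).symm
        rw [h2, hw k] at hl
        rcases hl.vert_eq_or (C.isLink k) with ⟨-, h3⟩ | ⟨-, h3⟩
        exacts [⟨_, h3.symm⟩, ⟨_, h3.symm⟩]
    obtain ⟨i, hi⟩ := hmem r (ht _)
    obtain ⟨k, rfl⟩ := hsurj i
    exact (w k).2 (by rw [hj, hi])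

/-- The vertices from which the set `W` is reached by a walk with `n` edges in `T`. -/
def levelSet (G : Graph α β) (T : Set β) (W : Set V(G)) : ℕ → Set V(G)
  | 0 => W
  | n + 1 => {v | ∃ e ∈ T, ∃ w ∈ levelSet G T W n, G.IsLink e v w}

/-- If a set of vertices is reached from everywhere, there are rotors leading to it. -/
lemma exists_rotors_towards {T : Set β} {W : Set V(G)}
    (hW : ∀ v, ∃ w ∈ W, G.ReachesIn T v w) :
    ∃ ρ : {v : V(G) // v ∉ W} → β, (∀ v, ρ v ∈ T ∧ G.Inc (ρ v) v.1) ∧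
      ∀ v, ∃ w ∈ W, Relation.ReflTransGen
        (fun a b : V(G) => ∃ h : a ∉ W, G.IsLink (ρ ⟨a, h⟩) a b) v w := by
  classical
  have h1 : ∀ v, ∃ n, v ∈ G.levelSet T W n := by
    intro v
    obtain ⟨w, hw, h⟩ := hW v
    induction h using Relation.ReflTransGen.head_induction_on with
    | refl => exact ⟨0, hw⟩
    | head h1 _ ih =>
      obtain ⟨n, hn⟩ := ih
      obtain ⟨e, he, hl⟩ := h1
      exact ⟨n + 1, e, he, _, hn, hl⟩
  -- The rotor at `v` is the first edge of a shortest walk to `W`, so the distance to `W` decreases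
  -- along rotors.
  have h2 : ∀ v : {v : V(G) // v ∉ W}, ∃ e ∈ T, ∃ w : V(G), G.IsLink e v.1 w ∧
      Nat.find (h1 w) < Nat.find (h1 v.1) := by
    rintro ⟨v, hv⟩
    have h3 := Nat.find_spec (h1 v)
    generalize Nat.find (h1 v) = n at *
    cases n with
    | zero => exact absurd h3 hv
    | succ n =>
      obtain ⟨e, he, w, hw, hl⟩ := h3
      exact ⟨e, he, w, hl, Nat.lt_succ_of_le (Nat.find_min' _ hw)⟩
  choose ρ hρ t ht hlt using h2
  refine ⟨ρ, fun v => ⟨hρ v, (ht v).inc_left⟩, fun v => ?_⟩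
  induction hn : Nat.find (h1 v) using Nat.strong_induction_on generalizing v with
  | _ n ih =>
    subst hn
    by_cases hv : v ∈ W
    · exact ⟨v, hv, .refl⟩
    · obtain ⟨w, hw, h⟩ := ih _ (hlt ⟨v, hv⟩) _ rfl
      exact ⟨w, hw, .head ⟨hv, ht ⟨v, hv⟩⟩ h⟩

/-- Every spanning tree can be oriented towards every root. -/
lemma IsSpanningTree.exists_isOrientedTowards {T : Set β} (hT : G.IsSpanningTree T) (r : V(G)) :
    ∃ ρ : G.Rotors r, G.IsOrientedTowards r T ρ := by
  obtain ⟨ρ, h1, h2⟩ := exists_rotors_towards (T := T) (W := {r})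
    fun v => ⟨r, rfl, hT.connected v r⟩
  simp only [Set.mem_singleton_iff, exists_eq_left] at h2
  have h3 := isSpanningTree_range (r := r) (ρ := ρ) (fun v => (h1 v).2) h2
  refine ⟨ρ, fun v => (h1 v).2, ?_, h2⟩
  refine Set.Subset.antisymm (by rintro _ ⟨v, rfl⟩; exact (h1 v).1) fun e he => ?_
  -- The rotors already form a spanning tree inside `T`; a further edge of `T` would close a cycle
  -- with a path in that tree.
  by_contra hne
  obtain ⟨a, b, hl⟩ := exists_isLink_of_mem_edgeSet (hT.subset he)
  have : Nonempty β := ⟨e⟩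
  obtain ⟨n, p, f, hp, hp0, hpn, -⟩ := exists_isPathIn (T := Set.range ρ)
    (fun _ _ h => h) (h3.connected ⟨a, hl.left_mem⟩ ⟨b, hl.right_mem⟩)
  refine hT.acyclic ⟨OrientedCycle.ofPath hp e (by rw [hp0, hpn]; exact hl.symm) ?_,
    OrientedCycle.ofPath_edge_mem _ _ _ _ ?_ he⟩
  · rintro k hk rfl
    exact hne (hp.mem k hk)
  · rintro _ ⟨v, rfl⟩
    exact (h1 v).1

namespace IsOrientedTowards

lemma not_mutual {r : V(G)} {T : Set β} {ρ : G.Rotors r} (h : G.IsOrientedTowards r T ρ)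
    {v w : V(G)} {hv : v ≠ r} {hw : w ≠ r} (h1 : G.IsLink (ρ ⟨v, hv⟩) v w)
    (h2 : G.IsLink (ρ ⟨w, hw⟩) w v) : False := by
  have hmem : ∀ u, Relation.ReflTransGen
      (fun a b : V(G) => ∃ h : a ≠ r, G.IsLink (ρ ⟨a, h⟩) a b) v u → u = v ∨ u = w := by
    intro u hu
    induction hu with
    | refl => exact .inl rfl
    | tail _ h ih =>
      obtain ⟨h, hl⟩ := h
      rcases ih with rfl | rfl
      · exact .inr (hl.vert_right_unique h1)
      · exact .inl (hl.vert_right_unique h2)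
  rcases hmem r (h.towards v) with h | h
  exacts [hv h.symm, hw h.symm]

/-- By induction along the path to the root. The edge `ρ v`, from `v` to `w`, is the `σ`-rotor of
one of its ends; if that end were `w`, the induction hypothesis would make the `ρ`-rotors at `v` and
`w` point at each other. -/
lemma unique {r : V(G)} {T : Set β} {ρ σ : G.Rotors r} (hρ : G.IsOrientedTowards r T ρ)
    (hσ : G.IsOrientedTowards r T σ) : ρ = σ := by
  suffices h : ∀ v, ∀ hv : v ≠ r, ρ ⟨v, hv⟩ = σ ⟨v, hv⟩ from funext fun v => h v.1 v.2
  intro v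
  induction hρ.towards v using Relation.ReflTransGen.head_induction_on with
  | refl => exact fun h => absurd rfl h
  | @head v w h _ ih =>
    intro hv
    have hl : G.IsLink (ρ ⟨v, hv⟩) v w := h.2
    have h1 : ρ ⟨v, hv⟩ ∈ Set.range σ := by
      rw [hσ.range_eq, ← hρ.range_eq]
      exact ⟨_, rfl⟩
    obtain ⟨⟨z, hz⟩, hzv⟩ := h1
    obtain ⟨u, hu⟩ := (hσ.inc ⟨z, hz⟩).exists_isLink
    rw [hzv] at hu
    rcases hu.vert_eq_or hl with ⟨rfl, -⟩ | ⟨rfl, -⟩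
    · exact hzv.symm
    · rw [← ih hz] at hzv
      refine (hρ.not_mutual hl (hw := hz) ?_).elim
      rw [hzv]
      exact hl.symm

end IsOrientedTowards

open Classical in
/-- The indicator function of the rotors. -/
def rotorInd {r : V(G)} (ρ : G.Rotors r) : V(G) → β → ℤ :=
  fun v e => if ∃ h : v ≠ r, ρ ⟨v, h⟩ = e then 1 else 0

open Classical in
/-- Moving the root of an oriented tree along one of its edges reverses this edge. -/
lemma IsOrientedTowards.exists_shift [G.Loopless] {r s : V(G)} {T : Set β} {ρ : G.Rotors r}
    (h : G.IsOrientedTowards r T ρ) {e : β} (he : e ∈ T) (hl : G.IsLink e r s) :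
    ∃ σ : G.Rotors s, G.IsOrientedTowards s T σ ∧
      rotorInd σ - rotorInd ρ = dartInd r e - dartInd s e := by
  have hrs := hl.vert_ne
  have hs : ρ ⟨s, hrs.symm⟩ = e := by
    rw [← h.range_eq] at he
    obtain ⟨⟨z, hz⟩, rfl⟩ := he
    obtain ⟨u, hu⟩ := (h.inc ⟨z, hz⟩).exists_isLink
    rcases hu.vert_eq_or hl with ⟨h1, -⟩ | ⟨h1, -⟩
    · exact absurd h1 hz
    · have : z = s := h1
      subst this
      rfl
  refine ⟨fun v => if hv : v.1 = r then e else ρ ⟨v.1, hv⟩, ⟨fun v => ?_, ?_, fun v => ?_⟩, ?_⟩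
  · split_ifs with hv
    · rw [hv]
      exact hl.inc_left
    · exact h.inc ⟨v.1, hv⟩
  · rw [← h.range_eq]
    ext g
    constructor
    · rintro ⟨v, rfl⟩
      dsimp only
      split_ifs with hv
      exacts [⟨_, hs⟩, ⟨_, rfl⟩]
    · rintro ⟨⟨v, hv⟩, rfl⟩
      by_cases hvs : v = s
      · subst hvs
        exact ⟨⟨r, hrs⟩, by simp [hs]⟩
      · exact ⟨⟨v, hvs⟩, by simp [hv]⟩
  · induction h.towards v using Relation.ReflTransGen.head_induction_on with
    | refl => exact .single ⟨hrs, by simpa using hl⟩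
    | @head v w h1 _ ih =>
      obtain ⟨hv, hl1⟩ := h1
      by_cases hvs : v = s
      · subst hvs
        exact .refl
      · exact .head ⟨hvs, by simpa [hv] using hl1⟩ ih
  · ext v g
    simp only [Pi.sub_apply, rotorInd, dartInd]
    by_cases hvr : v = r
    · subst hvr
      simp [hrs, eq_comm]
    · by_cases hvs : v = s
      · subst hvs
        simp [hvr, hs, eq_comm]
      · simp [hvr, hvs]

/-- A path extends to a spanning tree. -/
lemma IsConnected.exists_isSpanningTree (hG : G.IsConnected) {n : ℕ} {p : ℕ → V(G)} {f : ℕ → β}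
    (hp : G.IsPathIn E(G) n p f) : ∃ T, G.IsSpanningTree T ∧ ∀ k < n, f k ∈ T := by
  classical
  obtain ⟨ρ, h1, h2⟩ := exists_rotors_towards (T := E(G)) (W := p '' Set.Iic n)
    fun v => ⟨p 0, ⟨0, by simp, rfl⟩, hG.2 v (p 0)⟩
  have h3 : ∀ v, v ∈ p '' Set.Iic n → v ≠ p n → ∃ k, k < n ∧ p k = v := by
    rintro _ ⟨k, hk, rfl⟩ hkn
    refine ⟨k, lt_of_le_of_ne hk ?_, rfl⟩
    rintro rfl
    exact hkn rfl
  -- On the path, follow the path to its end `p n`; elsewhere, follow rotors leading to the path.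
  let σ : G.Rotors (p n) := fun v =>
    if hv : v.1 ∈ p '' Set.Iic n then f (h3 v.1 hv v.2).choose else ρ ⟨v.1, hv⟩
  have hσ1 : ∀ k < n, ∀ h : p k ≠ p n, σ ⟨p k, h⟩ = f k := by
    intro k hk h
    have hmem : p k ∈ p '' Set.Iic n := ⟨k, hk.le, rfl⟩
    have h4 := (h3 _ hmem h).choose_spec
    change (if hv : p k ∈ p '' Set.Iic n then f (h3 _ hv h).choose else ρ ⟨p k, hv⟩) = f k
    rw [dif_pos hmem]
    exact congrArg f (hp.injOn (Set.mem_Iic.2 h4.1.le) (Set.mem_Iic.2 hk.le) h4.2)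
  have hσ2 : ∀ v h, ∀ hv : v ∉ p '' Set.Iic n, σ ⟨v, h⟩ = ρ ⟨v, hv⟩ := fun v h hv => dif_neg hv
  have hne : ∀ k < n, p k ≠ p n := fun k hk h =>
    hk.ne (hp.injOn (Set.mem_Iic.2 hk.le) (Set.mem_Iic.2 le_rfl) h)
  refine ⟨Set.range σ, isSpanningTree_range (fun v => ?_) fun v => ?_, fun k hk =>
    ⟨⟨p k, hne k hk⟩, hσ1 k hk _⟩⟩
  · obtain ⟨v, hv⟩ := v
    by_cases hvp : v ∈ p '' Set.Iic n
    · obtain ⟨k, hk, rfl⟩ := h3 v hvp hv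
      rw [hσ1 k hk]
      exact (hp.isLink k hk).inc_left
    · rw [hσ2 v hv hvp]
      exact (h1 _).2
  · have h4 : ∀ m k, k + m = n → Relation.ReflTransGen
        (fun a b : V(G) => ∃ h : a ≠ p n, G.IsLink (σ ⟨a, h⟩) a b) (p k) (p n) := by
      intro m
      induction m with
      | zero =>
        rintro k rfl
        exact .refl
      | succ m ih =>
        intro k hk
        refine .head ⟨hne k (by omega), ?_⟩ (ih (k + 1) (by omega))
        rw [hσ1 k (by omega)]
        exact hp.isLink k (by omega)
    obtain ⟨w, ⟨k, hk, rfl⟩, hw⟩ := h2 v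
    refine Relation.ReflTransGen.trans (Relation.ReflTransGen.mono ?_ _ _ hw) (h4 (n - k) k ?_)
    · rintro a b ⟨ha, hl⟩
      have han : a ≠ p n := by
        rintro rfl
        exact ha ⟨n, Set.mem_Iic.2 le_rfl, rfl⟩
      exact ⟨han, by rw [hσ2 a han ha]; exact hl⟩
    · simp only [Set.mem_Iic] at hk
      omega

lemma rotorInd_root {r : V(G)} (ρ : G.Rotors r) (e : β) : rotorInd ρ r e = 0 :=
  if_neg fun ⟨h, _⟩ => h rfl

open Classical in
lemma rotorInd_apply {r v : V(G)} (ρ : G.Rotors r) (hv : v ≠ r) (e : β) :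
    rotorInd ρ v e = if e = ρ ⟨v, hv⟩ then 1 else 0 := by
  simp [rotorInd, hv, eq_comm]

/-- The orientation of a spanning tree towards a root. -/
def SpanningTree.rotors (T : G.SpanningTree) (r : V(G)) : G.Rotors r :=
  (T.2.exists_isOrientedTowards r).choose

lemma SpanningTree.isOrientedTowards (T : G.SpanningTree) (r : V(G)) :
    G.IsOrientedTowards r T.1 (T.rotors r) :=
  (T.2.exists_isOrientedTowards r).choose_spec

lemma IsOrientedTowards.eq_rotors {r : V(G)} {T : G.SpanningTree} {ρ : G.Rotors r}
    (h : G.IsOrientedTowards r T.1 ρ) : ρ = T.rotors r :=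
  h.unique (T.isOrientedTowards r)

instance [Finite E(G)] : Finite G.SpanningTree :=
  have : Finite {T : Set β | T ⊆ E(G)} := (Set.toFinite E(G)).finite_subsets
  Finite.of_injective (fun T : G.SpanningTree => (⟨T.1, T.2.subset⟩ : {T : Set β | T ⊆ E(G)}))
    fun _ _ h => Subtype.ext (congrArg (fun S : {T : Set β | T ⊆ E(G)} => S.1) h)

namespace RibbonStructure

variable {R : G.RibbonStructure}

/-! ### Arcs in a cyclic order -/

open Classical in
/-- The indicator function of the edges after `a` up to and including `b`. -/
def arcInd (R : G.RibbonStructure) (v : V(G)) (a b e : β) : ℤ :=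
  if R.IsBetween v a e b ∨ e = b then 1 else 0

lemma not_isBetween_right {v : V(G)} {a b : β} : ¬ R.IsBetween v a b b := by
  rintro ⟨m, hm, h1, h2⟩
  exact h2 m hm le_rfl h1.symm

lemma arcInd_nonneg {v : V(G)} {a b : β} (e : β) : 0 ≤ R.arcInd v a b e := by
  rw [arcInd]
  split_ifs <;> simp

lemma arcInd_le_one {v : V(G)} {a b : β} (e : β) : R.arcInd v a b e ≤ 1 := by
  rw [arcInd]
  split_ifs <;> simp

section arc

variable [Finite E(G)] {v : V(G)} {a b : β}

/-- Returning to `a` after `m` steps without meeting `b` makes the orbit of `a` periodic of period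
`m`, so it would never meet `b`, although all edges at `v` lie in one orbit. -/
lemma not_isBetween_left (ha : G.Inc a v) (hb : G.Inc b v) : ¬ R.IsBetween v a a b := by
  rintro ⟨m, hm, h1, h2⟩
  obtain ⟨n, hn, hab⟩ := R.exists_pow_eq ha hb
  have h3 : ∀ k, (R.next v ^ (m * k)) a = a := by
    intro k
    induction k with
    | zero => rfl
    | succ k ih => rw [Nat.mul_succ, pow_add, Equiv.Perm.mul_apply, ← h1, ih]
  have h4 : (R.next v ^ (n % m)) a = b := by
    rw [← hab]
    conv_rhs => rw [← Nat.mod_add_div n m, pow_add, Equiv.Perm.mul_apply, h3]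
  rcases Nat.eq_zero_or_pos (n % m) with h5 | h5
  · rw [h5] at h4
    refine h2 m hm le_rfl ?_
    rw [← h1, ← h4]
    rfl
  · exact h2 _ h5 (Nat.mod_lt _ hm).le h4

lemma arcInd_left (ha : G.Inc a v) (hb : G.Inc b v) (hab : a ≠ b) : R.arcInd v a b a = 0 :=
  if_neg fun h => h.elim (not_isBetween_left ha hb) hab

open Classical in
-- The arc indicator has jump `+1` after `a` and `-1` after `b`. Any function with these jumps is
-- therefore the arc indicator up to a constant, so all later facts about cyclic order reduce to
-- comparing jumps.
lemma arcInd_next (ha : G.Inc a v) (hb : G.Inc b v) (hab : a ≠ b) (e : β) :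
    R.arcInd v a b (R.next v e) - R.arcInd v a b e =
      (if e = a then 1 else 0) - (if e = b then 1 else 0) := by
  by_cases hea : e = a
  · subst hea
    rw [arcInd_left ha hb hab, if_pos rfl, if_neg hab, arcInd, if_pos]
    by_cases h : R.next v e = b
    · exact .inr h
    · refine .inl ⟨1, one_pos, by simp, fun j h1 h2 => ?_⟩
      obtain rfl : j = 1 := by omega
      simpa using h
  rw [if_neg hea]
  by_cases heb : e = b
  · subst heb
    have h0 : R.arcInd v a e e = 1 := if_pos (.inr rfl)
    rw [if_pos rfl, h0, arcInd, if_neg]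
    rintro (⟨m, hm, h1, h2⟩ | h)
    · obtain ⟨m, rfl⟩ := Nat.exists_eq_succ_of_ne_zero hm.ne'
      rw [pow_succ', Equiv.Perm.mul_apply, EmbeddingLike.apply_eq_iff_eq] at h1
      rcases Nat.eq_zero_or_pos m with rfl | hm'
      · exact hab h1.symm
      · exact h2 m hm' m.le_succ h1.symm
    · have h3 : ∀ n, (R.next v ^ n) e = e := by
        intro n
        induction n with
        | zero => rfl
        | succ n ih => rw [pow_succ, Equiv.Perm.mul_apply, h, ih]
      obtain ⟨n, -, hn⟩ := R.exists_pow_eq hb ha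
      exact hab (by rw [← hn, h3])
  rw [if_neg heb]
  have key : (R.IsBetween v a (R.next v e) b ∨ R.next v e = b) ↔
      (R.IsBetween v a e b ∨ e = b) := by
    constructor
    · rintro (⟨m, hm, h1, h2⟩ | h)
      · obtain ⟨m, rfl⟩ := Nat.exists_eq_succ_of_ne_zero hm.ne'
        rw [pow_succ', Equiv.Perm.mul_apply, EmbeddingLike.apply_eq_iff_eq] at h1
        rcases Nat.eq_zero_or_pos m with rfl | hm'
        · exact absurd h1 hea
        · exact .inl ⟨m, hm', h1, fun j hj hjm => h2 j hj (by omega)⟩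
      · have hex : ∃ n, 0 < n ∧ (R.next v ^ n) a = b := R.exists_pow_eq ha hb
        obtain ⟨hn, hnb⟩ := Nat.find_spec hex
        obtain ⟨n, hn'⟩ := Nat.exists_eq_succ_of_ne_zero hn.ne'
        rw [hn', ← h, pow_succ', Equiv.Perm.mul_apply, EmbeddingLike.apply_eq_iff_eq] at hnb
        rcases Nat.eq_zero_or_pos n with rfl | hn0
        · exact absurd hnb.symm hea
        · exact .inl ⟨n, hn0, hnb.symm, fun j hj hjn h' =>
            Nat.find_min hex (by omega) ⟨hj, h'⟩⟩
    · rintro (⟨m, hm, h1, h2⟩ | h)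
      · by_cases h : R.next v e = b
        · exact .inr h
        · refine .inl ⟨m + 1, m.succ_pos, by rw [pow_succ', Equiv.Perm.mul_apply, h1],
            fun j hj hjm => ?_⟩
          rcases Nat.lt_or_ge m j with h' | h'
          · obtain rfl : j = m + 1 := by omega
            rwa [pow_succ', Equiv.Perm.mul_apply, ← h1]
          · exact h2 j hj h'
      · exact absurd h heb
  rw [arcInd, arcInd, if_congr key rfl rfl, sub_self, sub_self]

open Classical in
/-- A function on the edges at `v` that increases after `a` and decreases after `b`. -/
lemma eq_add_arcInd {g : β → ℤ} (ha : G.Inc a v) (hb : G.Inc b v) (hab : a ≠ b)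
    (hg : ∀ e, G.Inc e v → g (R.next v e) - g e =
      (if e = a then 1 else 0) - (if e = b then 1 else 0)) {e : β} (he : G.Inc e v) :
    g e = g a + R.arcInd v a b e := by
  refine R.inc_induction (p := fun e => g e = g a + R.arcInd v a b e) ha he ?_ fun f hf h => ?_
  · rw [arcInd_left ha hb hab, add_zero]
  · have h1 := hg f hf
    have h2 := arcInd_next (R := R) ha hb hab f
    linarith

lemma eq_of_next_sub_eq_zero {g : β → ℤ} (hg : ∀ e, G.Inc e v → g (R.next v e) - g e = 0)
    {e f : β} (he : G.Inc e v) (hf : G.Inc f v) : g f = g e :=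
  R.inc_induction (p := fun f => g f = g e) he hf rfl fun h hh ih => by
    have := hg h hh
    linarith

end arc

/-! ### Uniqueness of the tree reached by turning the rotors -/

section unique

variable [Fintype V(G)] [Finite E(G)]

/-- Start at a dart where `c` is globally maximal and follow the rotors. A vertex with a maximal
dart has a maximal rotor, and conservation provides a maximal dart at the vertex it points to. The
maximum is thus carried to the root, where `c` is constant. -/
lemma le_of_max_rotors {c : V(G) → β → ℤ} (h0 : G.netFlow c = 0)
    (hosc : ∀ v, ∀ e ∈ G.incFinset v, ∀ f ∈ G.incFinset v, c v e ≤ c v f + 1) {r : V(G)}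
    {T : Set β} {ρ : G.Rotors r} (hρ : G.IsOrientedTowards r T ρ)
    (hmax : ∀ v, ∀ hv : v ≠ r, ∀ e, G.Inc e v → c v e ≤ c v (ρ ⟨v, hv⟩))
    (hr : ∀ e f, G.Inc e r → G.Inc f r → c r e = c r f) {v : V(G)} {e f : β} (he : G.Inc e v)
    (hf : G.Inc f r) : c v e ≤ c r f := by
  obtain ⟨⟨w, g⟩, hg, hM⟩ := Finset.exists_max_image (Finset.univ.sigma G.incFinset)
    (fun x => c x.1 x.2) ⟨⟨v, e⟩, by simpa [mem_incFinset] using he⟩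
  simp only [Finset.mem_sigma, Finset.mem_univ, true_and, mem_incFinset] at hg hM
  have hM' : ∀ v, ∀ e ∈ G.incFinset v, c v e ≤ c w g := fun v e he =>
    hM ⟨v, e⟩ (mem_incFinset.1 he)
  have key : ∀ u, Relation.ReflTransGen
      (fun a b : V(G) => ∃ h : a ≠ r, G.IsLink (ρ ⟨a, h⟩) a b) w u →
      ∃ h, G.Inc h u ∧ c u h = c w g := by
    intro u hu
    induction hu with
    | refl => exact ⟨g, hg, rfl⟩
    | @tail x y _ h ih =>
      obtain ⟨hx, hl⟩ := h
      obtain ⟨k, hk, hkM⟩ := ih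
      refine exists_max_dart_of_max_dart h0 hM' hosc hl (le_antisymm ?_ ?_)
      · exact hM' _ _ (mem_incFinset.2 hl.inc_left)
      · rw [← hkM]
        exact hmax x hx k hk
  obtain ⟨h, hh, hhM⟩ := key r (hρ.towards w)
  rw [hr f h hf hh, hhM]
  exact hM ⟨v, e⟩ he

/-- At each `v ≠ r` the flow is smallest at `ρ` and largest at `σ`. The maximum principle along `σ`,
and along `ρ` for `-c`, bounds `c` from both sides by its value at the root. So `c` has no jumps,
which forces `ρ = σ`. -/
lemma Turns.rotors_eq {r : V(G)} {T T' : Set β} {ρ σ : G.Rotors r}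
    (hρ : G.IsOrientedTowards r T ρ) (hσ : G.IsOrientedTowards r T' σ)
    (h : R.Turns (rotorInd ρ - rotorInd σ) 0) : ρ = σ := by
  classical
  obtain ⟨c, hc, h0⟩ := h
  have hr : ∀ e f, G.Inc e r → G.Inc f r → c r e = c r f := fun e f he hf =>
    eq_of_next_sub_eq_zero (R := R)
      (fun g hg => by rw [hc r g hg, Pi.sub_apply, Pi.sub_apply, rotorInd_root, rotorInd_root]; simp)
      hf he
  have hc' : ∀ v, ∀ hv : v ≠ r, ∀ e, G.Inc e v → c v (R.next v e) - c v e =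
      (if e = ρ ⟨v, hv⟩ then 1 else 0) - (if e = σ ⟨v, hv⟩ then 1 else 0) := by
    intro v hv e he
    rw [hc v e he, Pi.sub_apply, Pi.sub_apply, rotorInd_apply ρ hv, rotorInd_apply σ hv]
  have hval : ∀ v, ∀ hv : v ≠ r, ∀ e, G.Inc e v → c v (ρ ⟨v, hv⟩) ≤ c v e ∧
      c v e ≤ c v (σ ⟨v, hv⟩) ∧ c v (σ ⟨v, hv⟩) ≤ c v (ρ ⟨v, hv⟩) + 1 := by
    intro v hv e he
    have h1 := hc' v hv
    have h2 := hρ.inc ⟨v, hv⟩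
    have h3 := hσ.inc ⟨v, hv⟩
    by_cases h : ρ ⟨v, hv⟩ = σ ⟨v, hv⟩
    · rw [h] at h1 h2 ⊢
      have h4 : c v e = c v (σ ⟨v, hv⟩) :=
        eq_of_next_sub_eq_zero (R := R) (fun g hg => by rw [h1 g hg, sub_self]) h2 he
      rw [h4]
      simp
    · have h7 : c v e = _ := eq_add_arcInd h2 h3 h h1 he
      have h8 : c v (σ ⟨v, hv⟩) = _ := eq_add_arcInd h2 h3 h h1 h3
      have h4 : R.arcInd v (ρ ⟨v, hv⟩) (σ ⟨v, hv⟩) (σ ⟨v, hv⟩) = 1 := if_pos (.inr rfl)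
      have h5 := arcInd_nonneg (R := R) (v := v) (a := ρ ⟨v, hv⟩) (b := σ ⟨v, hv⟩) e
      have h6 := arcInd_le_one (R := R) (v := v) (a := ρ ⟨v, hv⟩) (b := σ ⟨v, hv⟩) e
      dsimp only at h4 h5 h6 h7 h8
      omega
  have hosc : ∀ v, ∀ e ∈ G.incFinset v, ∀ f ∈ G.incFinset v, c v e ≤ c v f + 1 := by
    intro v e he f hf
    rw [mem_incFinset] at he hf
    by_cases hv : v = r
    · subst hv
      rw [hr e f he hf]
      omega
    · have := hval v hv e he
      have := hval v hv f hf
      omega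
  funext ⟨v, hv⟩
  have h2 := hρ.inc ⟨v, hv⟩
  obtain ⟨f, hf⟩ : ∃ f, G.Inc f r := by
    rcases Relation.ReflTransGen.cases_tail (hρ.towards v) with h | ⟨u, -, h3⟩
    · exact absurd h.symm hv
    · exact ⟨_, h3.2.inc_right⟩
  have hle := fun e (he : G.Inc e v) =>
    le_of_max_rotors h0 hosc hσ (fun v hv e he => (hval v hv e he).2.1) hr he hf
  have hge := fun e (he : G.Inc e v) =>
    le_of_max_rotors (c := -c) (by rw [netFlow_neg, h0, neg_zero])
    (fun v e he f hf => by
      have := hosc v f hf e he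
      simp only [Pi.neg_apply]
      omega) hρ
    (fun v hv e he => neg_le_neg (hval v hv e he).1) (fun e f he hf => congrArg Neg.neg (hr e f he hf))
    he hf
  simp only [Pi.neg_apply, neg_le_neg_iff] at hge
  have h3 := hc' v hv _ h2
  rw [if_pos rfl, le_antisymm (hle _ h2) (hge _ h2),
    le_antisymm (hle _ (inc_next.2 h2)) (hge _ (inc_next.2 h2)), sub_self] at h3
  by_contra hne
  have hne' : ρ ⟨v, hv⟩ ≠ σ ⟨v, hv⟩ := hne
  rw [if_neg hne'] at h3
  omega

lemma Turns.tree_eq {r : V(G)} {T T' : G.SpanningTree}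
    (h : R.Turns (rotorInd (T.rotors r) - rotorInd (T'.rotors r)) 0) : T = T' := by
  have h1 := T.isOrientedTowards r
  have h2 := T'.isOrientedTowards r
  refine Subtype.ext ?_
  rw [← h1.range_eq, ← h2.range_eq, h.rotors_eq h1 h2]

end unique

end RibbonStructure

namespace RibbonStructure

variable {R : G.RibbonStructure}

/-! ### The rotor-routing process -/

section process

lemma RotorStep.inc {r : V(G)} {s t : G.Rotors r × V(G)} (h : R.RotorStep r s t)
    (hs : ∀ v, G.Inc (s.1 v) v.1) (v : {v : V(G) // v ≠ r}) : G.Inc (t.1 v) v.1 := by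
  classical
  obtain ⟨hx, h1, -⟩ := h
  rw [h1]
  by_cases hv : v = ⟨s.2, hx⟩
  · subst hv
    rw [Function.update_self]
    exact inc_next.2 (hs _)
  · rw [Function.update_of_ne hv]
    exact hs v

lemma exists_rotorStep {r : V(G)} {s : G.Rotors r × V(G)} (hx : s.2 ≠ r)
    (hs : ∀ v, G.Inc (s.1 v) v.1) : ∃ t, R.RotorStep r s t := by
  classical
  obtain ⟨y, hy⟩ := (show G.Inc (R.next s.2 (s.1 ⟨s.2, hx⟩)) s.2 from
    inc_next.2 (hs ⟨s.2, hx⟩)).exists_isLink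
  refine ⟨⟨Function.update s.1 ⟨s.2, hx⟩ (R.next s.2 (s.1 ⟨s.2, hx⟩)), y⟩, hx, ?_, ?_⟩
  · congr
  · dsimp only
    rw [Function.update_self]
    exact hy

open Classical in
lemma RotorStep.turns [Fintype V(G)] [Finite E(G)] [G.Loopless] {r : V(G)}
    {s t : G.Rotors r × V(G)} (h : R.RotorStep r s t) :
    R.Turns (rotorInd s.1 - rotorInd t.1) (Pi.single s.2 1 - Pi.single t.2 1) := by
  obtain ⟨hx, h1, h2⟩ := h
  rw [h1, Function.update_self] at h2
  have h3 : rotorInd s.1 - rotorInd t.1 = dartInd s.2 (s.1 ⟨s.2, hx⟩) -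
      dartInd s.2 (R.next s.2 (s.1 ⟨s.2, hx⟩)) := by
    ext v e
    simp only [Pi.sub_apply]
    by_cases hv : v = s.2
    · subst hv
      rw [rotorInd_apply _ hx, rotorInd_apply _ hx, h1, Function.update_self]
      simp [dartInd]
    · rw [dartInd_apply_of_ne hv, dartInd_apply_of_ne hv]
      by_cases hvr : v = r
      · subst hvr
        rw [rotorInd_root, rotorInd_root]
      · rw [rotorInd_apply _ hvr, rotorInd_apply _ hvr, h1, Function.update_of_ne]
        · simp
        · exact fun h => hv (congrArg Subtype.val h)
  rw [h3, ← netFlow_dartInd h2]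
  exact .next _ _

open Classical in
lemma turns_of_reflTransGen [Fintype V(G)] [Finite E(G)] [G.Loopless] {r : V(G)}
    {s t : G.Rotors r × V(G)} (h : Relation.ReflTransGen (R.RotorStep r) s t) :
    R.Turns (rotorInd s.1 - rotorInd t.1) (Pi.single s.2 1 - Pi.single t.2 1) := by
  induction h with
  | refl =>
    rw [sub_self, sub_self]
    exact .zero
  | tail _ h ih =>
    have := ih.add h.turns
    rwa [sub_add_sub_cancel, sub_add_sub_cancel] at this

lemma RoutesTo.turns [Fintype V(G)] [Finite E(G)] [G.Loopless] {r x : V(G)}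
    {T T' : G.SpanningTree} (h : R.RoutesTo r x T T') :
    R.Turns (rotorInd (T.rotors r) - rotorInd (T'.rotors r)) (G.divSub x r) := by
  obtain ⟨ρ, σ, hρ, hσ, h⟩ := h
  rw [← hρ.eq_rotors, ← hσ.eq_rotors]
  exact turns_of_reflTransGen h

/-- In the course of the process, the rotors lead from everywhere to the root or to the chip. -/
lemma RotorStep.leads_to {r : V(G)} {s t : G.Rotors r × V(G)} (h : R.RotorStep r s t)
    (hs : ∀ v, ∃ w, (w = r ∨ w = s.2) ∧ Relation.ReflTransGen (fun a b : V(G) =>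
      ∃ h : a ≠ r, a ≠ s.2 ∧ G.IsLink (s.1 ⟨a, h⟩) a b) v w) (v : V(G)) :
    ∃ w, (w = r ∨ w = t.2) ∧ Relation.ReflTransGen (fun a b : V(G) =>
      ∃ h : a ≠ r, a ≠ t.2 ∧ G.IsLink (t.1 ⟨a, h⟩) a b) v w := by
  classical
  obtain ⟨hx, h1, h2⟩ := h
  obtain ⟨w, hw, h⟩ := hs v
  induction h using Relation.ReflTransGen.head_induction_on with
  | refl =>
    rcases hw with rfl | rfl
    · exact ⟨_, .inl rfl, .refl⟩
    · by_cases h : s.2 = t.2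
      · exact ⟨_, .inr h, .refl⟩
      · exact ⟨_, .inr rfl, .single ⟨hx, h, h2⟩⟩
  | @head a b hab _ ih =>
    obtain ⟨har, has, hl⟩ := hab
    by_cases hat : a = t.2
    · exact ⟨_, .inr hat, .refl⟩
    · obtain ⟨u, hu, h⟩ := ih
      refine ⟨u, hu, .head ⟨har, hat, ?_⟩ h⟩
      rw [h1, Function.update_of_ne]
      · exact hl
      · exact fun h => has (congrArg Subtype.val h)

/-- A run of the rotor-routing process cannot go on forever. -/
lemma not_infinite_run [Finite V(G)] [Finite E(G)] (hG : G.IsConnected) {r : V(G)}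
    {u : ℕ → G.Rotors r × V(G)} (hinc : ∀ n v, G.Inc ((u n).1 v) v.1)
    (hstep : ∀ n, R.RotorStep r (u n) (u (n + 1))) : False := by
  classical
  have hr : ∀ n, (u n).2 ≠ r := fun n => (hstep n).1
  have hex : ∃ v, ∃ᶠ n in Filter.atTop, (u n).2 = v := by
    by_contra h
    simp only [not_exists, Filter.not_frequently] at h
    obtain ⟨n, hn⟩ := (Filter.eventually_all.2 h).exists
    exact hn _ rfl
  have hrot : ∀ v, ∀ hv : v ≠ r, (∃ᶠ n in Filter.atTop, (u n).2 = v) →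
      ∃ e, G.Inc e v ∧ ∃ᶠ n in Filter.atTop, (u n).2 = v ∧ (u n).1 ⟨v, hv⟩ = e := by
    intro v hv h
    by_contra h'
    simp only [not_exists, not_and, Filter.not_frequently] at h'
    have h2 : ∀ᶠ n in Filter.atTop, ∀ e ∈ G.incFinset v, ¬ ((u n).2 = v ∧ (u n).1 ⟨v, hv⟩ = e) :=
      (Filter.eventually_all_finset _).2 fun e he => by simpa using h' e (mem_incFinset.1 he)
    obtain ⟨n, hn, hn'⟩ := (h.and_eventually h2).exists
    exact hn' _ (mem_incFinset.2 (hinc n ⟨v, hv⟩)) ⟨hn, rfl⟩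
  have hkeep : ∀ v, ∀ hv : v ≠ r, ∀ n, (u n).2 ≠ v → (u (n + 1)).1 ⟨v, hv⟩ = (u n).1 ⟨v, hv⟩ := by
    intro v hv n hn
    rw [(hstep n).2.1, Function.update_of_ne]
    exact fun h => hn (congrArg Subtype.val h).symm
  have hturn : ∀ v, ∀ hv : v ≠ r, ∀ n, (u n).2 = v →
      (u (n + 1)).1 ⟨v, hv⟩ = R.next v ((u n).1 ⟨v, hv⟩) := by
    rintro v hv n rfl
    rw [(hstep n).2.1, Function.update_self]
  -- After a departure from `v`, its rotor stays fixed until the chip returns, so the next visit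
  -- finds it advanced exactly once. A vertex visited infinitely often thus uses every edge
  -- infinitely often.
  have hnext : ∀ v, ∀ hv : v ≠ r, (∃ᶠ n in Filter.atTop, (u n).2 = v) → ∀ e,
      (∃ᶠ n in Filter.atTop, (u n).2 = v ∧ (u n).1 ⟨v, hv⟩ = e) →
      ∃ᶠ n in Filter.atTop, (u n).2 = v ∧ (u n).1 ⟨v, hv⟩ = R.next v e := by
    intro v hv hinf e he
    rw [Filter.frequently_atTop] at hinf he ⊢
    intro N
    obtain ⟨n, hnN, hn, rfl⟩ := he N
    have hex : ∃ k, (u (n + 1 + k)).2 = v := by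
      obtain ⟨m, hm, h⟩ := hinf (n + 1)
      exact ⟨m - (n + 1), by rwa [Nat.add_sub_cancel' hm]⟩
    have hconst : ∀ k, k ≤ Nat.find hex →
        (u (n + 1 + k)).1 ⟨v, hv⟩ = R.next v ((u n).1 ⟨v, hv⟩) := by
      intro k
      induction k with
      | zero => exact fun _ => hturn v hv n hn
      | succ k ih =>
        intro hk
        rw [← ih (by omega)]
        exact hkeep v hv _ (Nat.find_min hex (by omega))
    exact ⟨_, by omega, Nat.find_spec hex, hconst _ le_rfl⟩
  have hadj : ∀ v w : V(G), (∃ᶠ n in Filter.atTop, (u n).2 = v) → ∀ e, G.IsLink e v w →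
      ∃ᶠ n in Filter.atTop, (u n).2 = w := by
    intro v w h e hl
    have hv : v ≠ r := by
      obtain ⟨n, rfl⟩ := h.exists
      exact hr n
    obtain ⟨f, hf, hfreq⟩ := hrot v hv h
    -- The rotor is advanced before the chip moves: the chip leaves along `e` when it finds the
    -- rotor at the predecessor of `e`.
    have he : G.Inc ((R.next v).symm e) v := by
      rw [← inc_next (R := R), Equiv.apply_symm_apply]
      exact hl.inc_left
    have h1 := R.inc_induction
      (p := fun g => ∃ᶠ n in Filter.atTop, (u n).2 = v ∧ (u n).1 ⟨v, hv⟩ = g) hf he hfreq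
      fun g _ hg => hnext v hv h g hg
    rw [Filter.frequently_atTop] at h1 ⊢
    intro N
    obtain ⟨n, hn, h2, h3⟩ := h1 N
    refine ⟨n + 1, by omega, ?_⟩
    obtain ⟨hx, -, h4⟩ := hstep n
    subst h2
    rw [hturn _ hv n rfl, h3, Equiv.apply_symm_apply] at h4
    exact h4.vert_right_unique hl
  obtain ⟨v, hv⟩ := hex
  have hall : ∀ w, G.ReachesIn E(G) v w → ∃ᶠ n in Filter.atTop, (u n).2 = w := by
    intro w hvw
    induction hvw with
    | refl => exact hv
    | tail _ h ih =>
      obtain ⟨e, -, hl⟩ := h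
      exact hadj _ _ ih e hl
  obtain ⟨n, hn⟩ := (hall r (hG.2 v r)).exists
  exact hr n hn

/-- The rotor-routing process stops at the root. -/
lemma exists_run_to_root [Finite V(G)] [Finite E(G)] (hG : G.IsConnected) {r : V(G)}
    (s : G.Rotors r × V(G)) (hs : ∀ v, G.Inc (s.1 v) v.1) :
    ∃ σ, Relation.ReflTransGen (R.RotorStep r) s (σ, r) := by
  by_contra hcon
  push Not at hcon
  let S := {t : G.Rotors r × V(G) //
    Relation.ReflTransGen (R.RotorStep r) s t ∧ ∀ v, G.Inc (t.1 v) v.1}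
  have hnext : ∀ t : S, ∃ t' : S, R.RotorStep r t.1 t'.1 := by
    rintro ⟨⟨σ, x⟩, ht, hinc⟩
    have hx : x ≠ r := by
      rintro rfl
      exact hcon σ ht
    obtain ⟨t', ht'⟩ := exists_rotorStep (R := R) (s := (σ, x)) hx hinc
    exact ⟨⟨t', ht.tail ht', ht'.inc hinc⟩, ht'⟩
  choose nxt hnxt using hnext
  let u : ℕ → S := fun n => nxt^[n] ⟨s, .refl, hs⟩
  refine not_infinite_run (R := R) hG (u := fun n => (u n).1) (fun n => (u n).2.2) fun n => ?_
  change R.RotorStep r (u n).1 (nxt^[n + 1] ⟨s, .refl, hs⟩).1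
  rw [Function.iterate_succ_apply']
  exact hnxt _

/-- The invariant `RotorStep.leads_to` ignores the rotor under the chip. Once the chip is at `r`, it
says precisely that all rotors lead to `r`, so they form an oriented spanning tree. -/
lemma exists_routesTo [Finite V(G)] [Finite E(G)] (hG : G.IsConnected) (r x : V(G))
    (T : G.SpanningTree) : ∃ T', R.RoutesTo r x T T' := by
  have hρ := T.isOrientedTowards r
  obtain ⟨σ, h⟩ := exists_run_to_root (R := R) hG (T.rotors r, x) hρ.inc
  have key : ∀ t, Relation.ReflTransGen (R.RotorStep r) (T.rotors r, x) t →
      (∀ v, G.Inc (t.1 v) v.1) ∧ ∀ v, ∃ w, (w = r ∨ w = t.2) ∧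
        Relation.ReflTransGen (fun a b : V(G) =>
          ∃ h : a ≠ r, a ≠ t.2 ∧ G.IsLink (t.1 ⟨a, h⟩) a b) v w := by
    intro t ht
    induction ht with
    | refl =>
      refine ⟨hρ.inc, fun v => ?_⟩
      induction hρ.towards v using Relation.ReflTransGen.head_induction_on with
      | refl => exact ⟨r, .inl rfl, .refl⟩
      | @head a b hab _ ih =>
        by_cases hax : a = x
        · exact ⟨a, .inr hax, .refl⟩
        · obtain ⟨w, hw, h⟩ := ih
          exact ⟨w, hw, .head ⟨hab.1, hax, hab.2⟩ h⟩
    | tail _ h ih => exact ⟨h.inc ih.1, h.leads_to ih.2⟩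
  obtain ⟨hinc, hlead⟩ := key _ h
  have ht : ∀ v : V(G), Relation.ReflTransGen
      (fun a b : V(G) => ∃ h : a ≠ r, G.IsLink (σ ⟨a, h⟩) a b) v r := by
    intro v
    obtain ⟨w, hw, h'⟩ := hlead v
    obtain rfl : w = r := hw.elim id id
    exact Relation.ReflTransGen.mono (fun a b ⟨h1, _, h2⟩ => ⟨h1, h2⟩) _ _ h'
  exact ⟨⟨Set.range σ, isSpanningTree_range hinc ht⟩, T.rotors r, σ, hρ, ⟨hinc, rfl, ht⟩, h⟩

end process

/-! ### The rotor-routing action -/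

section action

variable [Fintype V(G)] [Finite E(G)] [G.Loopless]

omit [Finite E(G)] [G.Loopless] in
lemma mem_of_forall_divSub_mem (r : V(G)) {A : AddSubgroup G.divZero}
    (h : ∀ x, G.divSub x r ∈ A) (D : G.divZero) : D ∈ A := by
  classical
  have hD : D = ∑ x, D.1 x • G.divSub x r := by
    refine Subtype.ext (funext fun v => ?_)
    have h0 : ∑ x, D.1 x = 0 := D.2
    simp only [AddSubgroup.val_finsetSum, AddSubgroup.coe_zsmul, divSub, Finset.sum_apply,
      Pi.smul_apply, Pi.sub_apply, smul_eq_mul, mul_sub, Finset.sum_sub_distrib]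
    rw [← Finset.sum_mul, h0, zero_mul, sub_zero]
    simp [Pi.single_apply]
  rw [hD]
  exact A.sum_mem fun x _ => A.zsmul_mem (h x) _

variable (R)

/-- The divisors that can be applied to every tree form a subgroup containing all `x - r`. For
negatives: by uniqueness such a divisor acts injectively on the finite set of trees, hence
surjectively, so it can be undone. -/
lemma exists_turns (hG : G.IsConnected) (r : V(G)) (D : G.divZero) (T : G.SpanningTree) :
    ∃ T' : G.SpanningTree, R.Turns (rotorInd (T.rotors r) - rotorInd (T'.rotors r)) D := by
  let A : AddSubgroup G.divZero :=
    { carrier := {D | ∀ T : G.SpanningTree, ∃ T' : G.SpanningTree,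
        R.Turns (rotorInd (T.rotors r) - rotorInd (T'.rotors r)) D}
      zero_mem' := fun T => ⟨T, by rw [sub_self]; exact .zero⟩
      add_mem' := by
        intro D E hD hE T
        obtain ⟨T', h⟩ := hD T
        obtain ⟨T'', h'⟩ := hE T'
        have := h.add h'
        rw [sub_add_sub_cancel] at this
        exact ⟨T'', this⟩
      neg_mem' := by
        intro D hD
        choose f hf using hD
        have hinj : Function.Injective f := by
          intro T₁ T₂ h
          have h1 := (hf T₁).sub (hf T₂)
          rw [h, sub_self, sub_sub_sub_cancel_right] at h1
          exact h1.tree_eq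
        intro T
        obtain ⟨T', rfl⟩ := Finite.surjective_of_injective hinj T
        have := (hf T').neg
        rw [neg_sub] at this
        exact ⟨T', this⟩ }
  refine mem_of_forall_divSub_mem r (A := A) (fun x T => ?_) D T
  obtain ⟨T', h⟩ := exists_routesTo (R := R) hG r x T
  exact ⟨T', h.turns⟩

/-- The tree reached from `T` under the action of a class in the sandpile group. -/
def route (hG : G.IsConnected) (r : V(G)) (p : G.PicZero) (T : G.SpanningTree) : G.SpanningTree :=
  (R.exists_turns hG r p.out T).choose

lemma turns_route (hG : G.IsConnected) (r : V(G)) (D : G.divZero) (T : G.SpanningTree) :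
    R.Turns (rotorInd (T.rotors r) - rotorInd ((R.route hG r (D : G.PicZero) T).rotors r)) D := by
  have h1 := (R.exists_turns hG r (D : G.PicZero).out T).choose_spec
  -- The chosen representative of the class differs from `D` by a principal divisor, which full
  -- turns absorb.
  have h2 : -(D : G.PicZero).out + D ∈ G.principalDivisors.addSubgroupOf G.divZero :=
    QuotientAddGroup.eq.1 (Quotient.out_eq _)
  have h3 := h1.add (.of_mem_principalDivisors (R := R) (AddSubgroup.mem_addSubgroupOf.1 h2))
  rw [add_zero, AddSubgroup.coe_add, AddSubgroup.coe_neg, add_neg_cancel_left] at h3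
  exact h3

variable {R} in
lemma Turns.route_eq {hG : G.IsConnected} {r : V(G)} {D : G.divZero} {T T' : G.SpanningTree}
    (h : R.Turns (rotorInd (T.rotors r) - rotorInd (T'.rotors r)) D) :
    R.route hG r (D : G.PicZero) T = T' := by
  have := h.sub (R.turns_route hG r D T)
  rw [sub_self, sub_sub_sub_cancel_left] at this
  exact this.tree_eq

/-- The rotor-routing action. -/
def routingAction (hG : G.IsConnected) (r : V(G)) :
    Multiplicative G.PicZero →* Equiv.Perm G.SpanningTree :=
  MonoidHom.toHomPerm
    { toFun := fun p => R.route hG r p.toAdd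
      map_one' := funext fun T => by
        refine Turns.route_eq (D := 0) ?_
        rw [Function.End.one_def, id, sub_self]
        exact .zero
      map_mul' := fun p q => funext fun T => by
        obtain ⟨D, hD⟩ := QuotientAddGroup.mk_surjective p.toAdd
        obtain ⟨E, hE⟩ := QuotientAddGroup.mk_surjective q.toAdd
        rw [toAdd_mul, ← hD, ← hE]
        refine Turns.route_eq (D := D + E) ?_
        have := (R.turns_route hG r E T).add (R.turns_route hG r D (R.route hG r E T))
        rw [sub_add_sub_cancel, add_comm] at this
        exact this }

lemma routingAction_apply (hG : G.IsConnected) (r : V(G)) (D : G.divZero) (T : G.SpanningTree) :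
    R.routingAction hG r (.ofAdd D) T = R.route hG r D T := rfl

/-- The outcome of routing is determined by its `Turns` relation, and the classes of `x - r`
generate the group; existence of the outcome shows that the constructed action qualifies. -/
lemma isRotorRoutingAction_iff (hG : G.IsConnected) (r : V(G))
    (ψ : Multiplicative G.PicZero →* Equiv.Perm G.SpanningTree) :
    R.IsRotorRoutingAction r ψ ↔ ψ = R.routingAction hG r := by
  have key : ∀ x T T', R.RoutesTo r x T T' →
      R.routingAction hG r (.ofAdd (G.picSub x r)) T = T' := fun x T T' h =>
    Turns.route_eq (hG := hG) h.turns
  constructor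
  · intro h
    let A : AddSubgroup G.divZero :=
      ((ψ.eqLocus (R.routingAction hG r)).toAddSubgroup').comap
        (QuotientAddGroup.mk' (G.principalDivisors.addSubgroupOf G.divZero))
    refine MonoidHom.ext fun p => ?_
    obtain ⟨D, hD⟩ := QuotientAddGroup.mk_surjective p.toAdd
    have h1 : D ∈ A := by
      refine mem_of_forall_divSub_mem r (fun x => ?_) D
      change ψ (.ofAdd (G.picSub x r)) = R.routingAction hG r (.ofAdd (G.picSub x r))
      exact Equiv.ext fun T => (key x T _ (h x T)).symm
    rw [← ofAdd_toAdd p, ← hD]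
    exact h1
  · rintro rfl x T
    obtain ⟨T', h⟩ := exists_routesTo (R := R) hG r x T
    rwa [key x T T' h]

end action

end RibbonStructure

/-! ### Independence of the basepoint and reversible cycles -/

/-- The rotors of a tree with respect to different roots differ on the path between the roots. -/
lemma SpanningTree.rotorInd_sub [G.Loopless] (T : G.SpanningTree) {n : ℕ} {p : ℕ → V(G)}
    {f : ℕ → β} (hf : ∀ k < n, f k ∈ T.1) (hl : ∀ k < n, G.IsLink (f k) (p k) (p (k + 1))) :
    rotorInd (T.rotors (p n)) - rotorInd (T.rotors (p 0)) =
      ∑ k ∈ Finset.range n, (dartInd (p k) (f k) - dartInd (p (k + 1)) (f k)) := by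
  induction n with
  | zero => simp
  | succ n ih =>
    rw [Finset.sum_range_succ, ← ih (fun k hk => hf k (by omega)) (fun k hk => hl k (by omega))]
    obtain ⟨σ, hσ, h⟩ := (T.isOrientedTowards (p n)).exists_shift (hf n n.lt_succ_self)
      (hl n n.lt_succ_self)
    rw [← h, hσ.eq_rotors]
    abel

namespace RibbonStructure

variable {R : G.RibbonStructure}

variable (R) in
/-- A cycle is reversible if turning the rotors along it backwards is equivalent to doing
nothing. -/
def IsReversible [Finite E(G)] (C : G.OrientedCycle) : Prop := R.Turns C.turn 0

/-- Turning each rotor along the arc from its `ρ`-position to its `σ`-position achieves this; the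
divisor is whatever results. -/
lemma exists_turns_rotorInd [Finite E(G)] {r : V(G)} {ρ σ : G.Rotors r}
    (hρ : ∀ v, G.Inc (ρ v) v.1) (hσ : ∀ v, G.Inc (σ v) v.1) :
    ∃ D, R.Turns (rotorInd ρ - rotorInd σ) D := by
  classical
  refine ⟨_, fun v e => if h : v = r then 0 else if ρ ⟨v, h⟩ = σ ⟨v, h⟩ then 0 else
    R.arcInd v (ρ ⟨v, h⟩) (σ ⟨v, h⟩) e, fun v e _ => ?_, rfl⟩
  rw [Pi.sub_apply, Pi.sub_apply]
  by_cases hv : v = r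
  · subst hv
    simp [rotorInd_root]
  · rw [rotorInd_apply _ hv, rotorInd_apply _ hv]
    by_cases h : ρ ⟨v, hv⟩ = σ ⟨v, hv⟩
    · simp [hv, h]
    · simpa [hv, h] using arcInd_next (R := R) (hρ ⟨v, hv⟩) (hσ ⟨v, hv⟩) h e

section

variable [Fintype V(G)] [Finite E(G)] [G.Loopless]

omit [Fintype V(G)] in
-- The subtracted term `dartInd r e - dartInd s e` does not depend on `T`, so it cancels when two
-- trees are compared. If `e` is not in the tree, the remaining jumps are minus the turn of the
-- cycle that `e` closes with the tree path.
lemma turns_rotorInd_sub_of_isReversible (h : ∀ C, R.IsReversible C) (T : G.SpanningTree)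
    {r s : V(G)} {e : β} (hl : G.IsLink e r s) :
    R.Turns (rotorInd (T.rotors s) - rotorInd (T.rotors r) - (dartInd r e - dartInd s e)) 0 := by
  by_cases he : e ∈ T.1
  · obtain ⟨σ, hσ, h⟩ := (T.isOrientedTowards r).exists_shift he hl
    rw [← h, hσ.eq_rotors, sub_self]
    exact .zero
  · have : Nonempty β := ⟨e⟩
    obtain ⟨n, p, f, hp, rfl, rfl, -⟩ := exists_isPathIn (fun _ _ h => h) (T.2.connected r s)
    have h1 := h (OrientedCycle.ofPath hp e hl.symm (by
      rintro k hk rfl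
      exact he (hp.mem k hk)))
    rw [IsReversible, OrientedCycle.turn_ofPath] at h1
    have h2 := h1.neg
    rw [neg_zero] at h2
    rw [T.rotorInd_sub hp.mem hp.isLink]
    convert h2 using 1
    rw [neg_add, ← Finset.sum_neg_distrib, sub_eq_add_neg]
    simp only [neg_sub]

lemma routingAction_eq_of_isReversible (hG : G.IsConnected) (h : ∀ C, R.IsReversible C)
    (r s : V(G)) : R.routingAction hG r = R.routingAction hG s := by
  have hadj : ∀ (r s : V(G)) (e : β), G.IsLink e r s →
      R.routingAction hG r = R.routingAction hG s := by
    intro r s e hl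
    refine MonoidHom.ext fun p => Equiv.ext fun T => ?_
    obtain ⟨D, hD⟩ := QuotientAddGroup.mk_surjective p.toAdd
    rw [← ofAdd_toAdd p, ← hD, routingAction_apply, routingAction_apply]
    refine (Turns.route_eq ?_).symm
    set T' := R.route hG r D T
    have h1 := ((R.turns_route hG r D T).add (turns_rotorInd_sub_of_isReversible h T hl)).sub
      (turns_rotorInd_sub_of_isReversible h T' hl)
    rw [add_zero, sub_zero] at h1
    convert h1 using 1
    abel
  induction hG.2 r s with
  | refl => rfl
  | tail _ h' ih =>
    obtain ⟨e, -, hl⟩ := h'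
    rw [ih, hadj _ _ e hl]

/-- Choose a tree `S` containing all edges of `C` but the last, and a tree `S'` containing the last
edge. A divisor carrying `S` to `S'` at one end of that edge does so at the other end too.
Subtracting the two relations leaves the rotor changes of `S` along the long arc and of `S'` along
the last edge, which together are the turn of `C`. -/
lemma isReversible_of_routingAction_eq (hG : G.IsConnected)
    (h : ∀ r s, R.routingAction hG r = R.routingAction hG s) (C : G.OrientedCycle) :
    R.IsReversible C := by
  obtain ⟨n, hn⟩ := Nat.exists_eq_succ_of_ne_zero C.length_pos.ne'
  set p : ℕ → V(G) := fun k => C.vert (0 + k) with hp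
  set f : ℕ → β := fun k => C.edge (0 + k) with hf
  have hpath : G.IsPathIn E(G) n p f :=
    C.isPathIn 0 (by omega) fun k _ => (C.isLink _).edge_mem
  have hg : G.IsLink (f n) (p n) (p 0) := by
    have h1 := C.isLink n
    have h2 : (n : ZMod C.length) + 1 = 0 := by
      rw [← Nat.cast_succ, ← hn]
      exact ZMod.natCast_self _
    rw [h2] at h1
    simpa [hp, hf] using h1
  have hturn : C.turn = ∑ k ∈ Finset.range n, (dartInd (p (k + 1)) (f k) - dartInd (p k) (f k)) +
      (dartInd (p 0) (f n) - dartInd (p n) (f n)) := by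
    have h2 : (n : ZMod C.length) + 1 = 0 := by
      rw [← Nat.cast_succ, ← hn]
      exact ZMod.natCast_self _
    have h3 : C.turn = ∑ k ∈ Finset.range (n + 1),
      (dartInd (C.vert (k + 1)) (C.edge k) - dartInd (C.vert k) (C.edge k)) :=
      C.turn_eq_sum_range.trans (congrArg (fun N => Finset.sum (Finset.range N) _) hn)
    rw [h3, Finset.sum_range_succ, h2]
    simp [hp, hf]
  obtain ⟨T, hT, hTf⟩ := hG.exists_isSpanningTree hpath
  let q : ℕ → V(G) := fun k => if k = 0 then p 0 else p n
  have hq : G.IsPathIn E(G) 1 q fun _ => f n := by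
    refine ⟨fun _ _ => hg.edge_mem, fun k hk => ?_, fun k hk l hl hkl => ?_⟩
    · obtain rfl : k = 0 := by omega
      simpa [q] using hg.symm
    · simp only [Set.mem_Iic] at hk hl
      by_contra hne
      rcases (show k = 0 ∧ l = 1 ∨ k = 1 ∧ l = 0 by omega) with ⟨rfl, rfl⟩ | ⟨rfl, rfl⟩
      · exact hg.vert_ne (by simpa [q] using hkl.symm)
      · exact hg.vert_ne (by simpa [q] using hkl)
  obtain ⟨T', hT', hTf'⟩ := hG.exists_isSpanningTree hq
  let S : G.SpanningTree := ⟨T, hT⟩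
  let S' : G.SpanningTree := ⟨T', hT'⟩
  obtain ⟨D, hD⟩ := exists_turns_rotorInd (R := R) (S.isOrientedTowards (p 0)).inc
    (S'.isOrientedTowards (p 0)).inc
  have h1 : R.route hG (p 0) ((⟨D, hD.mem_divZero⟩ : G.divZero) : G.PicZero) S = S' :=
    Turns.route_eq (D := ⟨D, hD.mem_divZero⟩) hD
  rw [← routingAction_apply, h (p 0) (p n), routingAction_apply] at h1
  have h2 := R.turns_route hG (p n) ⟨D, hD.mem_divZero⟩ S
  rw [h1] at h2
  have h3 := hD.sub h2
  rw [sub_self] at h3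
  have h4 := S.rotorInd_sub (p := p) hTf hpath.isLink
  have h5 : rotorInd (S'.rotors (p n)) - rotorInd (S'.rotors (p 0)) =
      dartInd (p 0) (f n) - dartInd (p n) (f n) := by
    have := S'.rotorInd_sub (p := q) (n := 1) hTf' hq.isLink
    rw [Finset.sum_range_one] at this
    exact this
  have h6 : ∑ k ∈ Finset.range n, (dartInd (p (k + 1)) (f k) - dartInd (p k) (f k)) =
      -∑ k ∈ Finset.range n, (dartInd (p k) (f k) - dartInd (p (k + 1)) (f k)) := by
    rw [← Finset.sum_neg_distrib]
    simp only [neg_sub]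
  rw [IsReversible, hturn, h6, ← h4]
  rw [← h5]
  convert h3 using 1
  abel

end

/-! ### The two sides of a cycle -/

section sides

variable [Finite E(G)]

omit [Finite E(G)] in
lemma IsBetween.inc {v : V(G)} {a f b : β} (h : R.IsBetween v a f b) (ha : G.Inc a v) :
    G.Inc f v := by
  obtain ⟨m, -, rfl, -⟩ := h
  exact inc_pow ha m

omit [Finite E(G)] in
lemma IsBetween.ne_right {v : V(G)} {a f b : β} (h : R.IsBetween v a f b) : f ≠ b := by
  rintro rfl
  exact not_isBetween_right h

lemma IsBetween.ne_left {v : V(G)} {a f b : β} (h : R.IsBetween v a f b) (ha : G.Inc a v)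
    (hb : G.Inc b v) : f ≠ a := by
  rintro rfl
  exact not_isBetween_left ha hb h

omit [Finite E(G)] in
lemma arcInd_right {v : V(G)} {a b : β} : R.arcInd v a b b = 1 := if_pos (.inr rfl)

omit [Finite E(G)] in
lemma IsBetween.arcInd_eq {v : V(G)} {a f b : β} (h : R.IsBetween v a f b) :
    R.arcInd v a b f = 1 := if_pos (.inl h)

omit [Finite E(G)] in
lemma isBetween_of_arcInd_eq {v : V(G)} {a f b : β} (h : R.arcInd v a b f = 1) (hf : f ≠ b) :
    R.IsBetween v a f b := by
  rw [arcInd] at h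
  split_ifs at h with h'
  · exact h'.resolve_right hf
  · omega

lemma arcInd_add_swap {v : V(G)} {a b e : β} (ha : G.Inc a v) (hb : G.Inc b v) (hab : a ≠ b)
    (he : G.Inc e v) : R.arcInd v a b e + R.arcInd v b a e = 1 := by
  have h := eq_of_next_sub_eq_zero (R := R)
    (g := fun e => R.arcInd v a b e + R.arcInd v b a e) (fun f _ => by
      have h1 := arcInd_next (R := R) ha hb hab f
      have h2 := arcInd_next (R := R) hb ha hab.symm f
      linarith) ha he
  rw [h, arcInd_left ha hb hab, arcInd_right, zero_add]

/-- The jumps of the indicators of the arcs from `a` to `f`, from `f` to `b` and from `b` to `a`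
cancel, so their sum is constant; compare its values at `f` and `b`. -/
lemma IsBetween.rotate {v : V(G)} {a f b : β} (h : R.IsBetween v a f b) (ha : G.Inc a v)
    (hb : G.Inc b v) (hab : a ≠ b) : R.IsBetween v f b a := by
  have hf := h.inc ha
  have hfa := h.ne_left ha hb
  have hfb := h.ne_right
  refine isBetween_of_arcInd_eq ?_ hab.symm
  have hconst := eq_of_next_sub_eq_zero (R := R)
    (g := fun e => R.arcInd v a f e + R.arcInd v f b e + R.arcInd v b a e) (fun e _ => by
      have h1 := arcInd_next (R := R) ha hf hfa.symm e
      have h2 := arcInd_next (R := R) hf hb hfb e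
      have h3 := arcInd_next (R := R) hb ha hab.symm e
      linarith) hf hb
  have h1 := arcInd_add_swap (R := R) ha hb hab hf
  have h2 := arcInd_add_swap (R := R) ha hf hfa.symm hb
  rw [h.arcInd_eq] at h1
  rw [arcInd_right, arcInd_right, arcInd_left hb ha hab.symm, arcInd_left hf hb hfb] at hconst
  linarith

lemma not_isLeftOf_and_isRightOf [G.Loopless] {C : G.OrientedCycle} {i : ZMod C.length} {e : β}
    (h : R.IsLeftOf C i e) (h' : R.IsRightOf C i e) : False := by
  have h1 := arcInd_add_swap (R := R) (C.inc_in i) (C.inc_out i) (C.in_ne_out i)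
    (h.inc (C.inc_in i))
  rw [h.arcInd_eq, IsBetween.arcInd_eq h'] at h1
  omega

omit [Finite E(G)] in
lemma IsLeftOf.arcInd_eq {C : G.OrientedCycle} {i : ZMod C.length} {e : β}
    (h : R.IsLeftOf C i e) : R.arcInd (C.vert i) (C.edge (i - 1)) (C.edge i) e = 1 :=
  IsBetween.arcInd_eq h

lemma IsRightOf.arcInd_eq [G.Loopless] {C : G.OrientedCycle} {i : ZMod C.length} {e : β}
    (h : R.IsRightOf C i e) : R.arcInd (C.vert i) (C.edge (i - 1)) (C.edge i) e = 0 := by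
  have h1 := arcInd_add_swap (R := R) (C.inc_in i) (C.inc_out i) (C.in_ne_out i)
    (h.inc (C.inc_out i))
  rw [IsBetween.arcInd_eq h] at h1
  omega

lemma isRightOf_of_arcInd_ne_one [G.Loopless] {C : G.OrientedCycle} {i : ZMod C.length} {e : β}
    (h : R.arcInd (C.vert i) (C.edge (i - 1)) (C.edge i) e ≠ 1) (he : G.Inc e (C.vert i))
    (hin : e ≠ C.edge (i - 1)) : R.IsRightOf C i e := by
  have h1 := arcInd_add_swap (R := R) (C.inc_in i) (C.inc_out i) (C.in_ne_out i) he
  have h2 := arcInd_nonneg (R := R) (v := C.vert i) (a := C.edge (i - 1)) (b := C.edge i) e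
  have h3 := arcInd_le_one (R := R) (v := C.vert i) (a := C.edge (i - 1)) (b := C.edge i) e
  exact isBetween_of_arcInd_eq (by omega) hin

end sides

/-! ### Separating cycles are reversible -/

section separating

variable (R) in
/-- The vertices off a cycle that are reached from its left side without meeting the cycle. -/
def leftSide (C : G.OrientedCycle) : Set V(G) :=
  {u | ∃ i e, ∃ w : V(G), R.IsLeftOf C i e ∧ G.IsLink e (C.vert i) w ∧ w ∉ Set.range C.vert ∧
    Relation.ReflTransGen (fun a b : V(G) => b ∉ Set.range C.vert ∧ ∃ e ∈ E(G), G.IsLink e a b) w u}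

lemma isNonseparating_of_mem_leftSide [Finite E(G)] [G.Loopless] {C : G.OrientedCycle} {u : V(G)}
    (hu : u ∈ R.leftSide C) {e : β} {j : ZMod C.length} (hl : G.IsLink e u (C.vert j))
    (he : R.IsRightOf C j e) : R.IsNonseparating C := by
  obtain ⟨i, e₀, w, hleft, hl₀, hw, hwu⟩ := hu
  have : Nonempty β := ⟨e⟩
  obtain ⟨n, q, g, hq, rfl, rfl, hqr⟩ := exists_isPathIn (fun _ _ h => h.2) hwu
  have hoff : ∀ k ≤ n, q k ∉ Set.range C.vert := by
    intro k hk
    cases k with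
    | zero => exact hw
    | succ k => exact (hqr k hk).1
  have hgC : ∀ k < n, ∀ i, ¬ G.Inc (g k) (C.vert i) := by
    intro k hk i hi
    obtain ⟨x, hx⟩ := hi.exists_isLink
    rcases hx.vert_eq_or (hq.isLink k hk) with ⟨h, -⟩ | ⟨h, -⟩
    exacts [hoff k hk.le ⟨i, h⟩, hoff (k + 1) hk ⟨i, h⟩]
  have hee : e₀ ≠ e := by
    rintro rfl
    rcases hl₀.vert_eq_or hl with ⟨h, -⟩ | ⟨h, -⟩
    · exact hoff n le_rfl ⟨i, h⟩
    · obtain rfl := C.vert_injective h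
      exact not_isLeftOf_and_isRightOf hleft he
  -- The edge leaving `C` on the left, the path `q` off the cycle, and the edge returning on the
  -- right.
  let p : ℕ → V(G) := fun m => if m = 0 then C.vert i else if m ≤ n + 1 then q (m - 1) else C.vert j
  let f : ℕ → β := fun m => if m = 0 then e₀ else if m ≤ n then g (m - 1) else e
  have hp0 : p 0 = C.vert i := rfl
  have hp1 : ∀ m ≤ n, p (m + 1) = q m := by
    intro m hm
    simp [p, hm]
  have hp2 : p (n + 2) = C.vert j := by simp [p]
  have hf0 : f 0 = e₀ := rfl
  have hf1 : ∀ m < n, f (m + 1) = g m := by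
    intro m hm
    simp [f, Nat.succ_le_iff.2 hm]
  have hf2 : f (n + 1) = e := by simp [f]
  have hcases : ∀ m ≤ n + 1, m = 0 ∨ (∃ l < n, m = l + 1) ∨ m = n + 1 := by
    intro m hm
    rcases Nat.eq_zero_or_pos m with h | h
    · exact .inl h
    · by_cases h' : m = n + 1
      · exact .inr (.inr h')
      · exact .inr (.inl ⟨m - 1, by omega, by omega⟩)
  refine ⟨n + 1, p, f, i, j, fun m hm => ?_, fun m hm l hl' hml => ?_, hp0, hp2, fun m h0 hm => ?_,
    by rwa [hf0], by rwa [hf2]⟩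
  · rcases hcases m hm with rfl | ⟨l, hl', rfl⟩ | rfl
    · rw [hf0, hp0, hp1 0 n.zero_le]
      exact hl₀
    · rw [hf1 l hl', hp1 l hl'.le, hp1 (l + 1) hl']
      exact hq.isLink l hl'
    · rw [hf2, hp1 n le_rfl, hp2]
      exact hl
  · have hg₀ : ∀ k < n, g k ≠ e₀ := fun k hk h => hgC k hk i (h ▸ hl₀.inc_left)
    have hge : ∀ k < n, g k ≠ e := fun k hk h => hgC k hk j (h ▸ hl.inc_right)
    rcases hcases m hm with rfl | ⟨a, ha, rfl⟩ | rfl <;>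
    rcases hcases l hl' with rfl | ⟨b, hb, rfl⟩ | rfl
    · rfl
    · rw [hf0, hf1 b hb] at hml
      exact absurd hml.symm (hg₀ b hb)
    · rw [hf0, hf2] at hml
      exact absurd hml hee
    · rw [hf0, hf1 a ha] at hml
      exact absurd hml (hg₀ a ha)
    · rw [hf1 a ha, hf1 b hb] at hml
      rw [hq.edge_injOn ha hb hml]
    · rw [hf1 a ha, hf2] at hml
      exact absurd hml (hge a ha)
    · rw [hf0, hf2] at hml
      exact absurd hml.symm hee
    · rw [hf1 b hb, hf2] at hml
      exact absurd hml.symm (hge b hb)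
    · rfl
  · obtain ⟨m, rfl⟩ := Nat.exists_eq_succ_of_ne_zero h0.ne'
    rw [Nat.succ_eq_add_one, hp1 m (by omega)]
    exact hoff m (by omega)

lemma isReversible_of_not_isNonseparating [Finite E(G)] [G.Loopless] {C : G.OrientedCycle}
    (hC : ¬ R.IsNonseparating C) : R.IsReversible C := by
  classical
  -- The indicator of the left region: on `C` it has the prescribed jumps, off `C` it is constant at
  -- each vertex.
  let c : V(G) → β → ℤ := fun v e =>
    if h : ∃ i, C.vert i = v then R.arcInd v (C.edge (h.choose - 1)) (C.edge h.choose) e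
    else if v ∈ R.leftSide C then 1 else 0
  have hc1 : ∀ i e, c (C.vert i) e = R.arcInd (C.vert i) (C.edge (i - 1)) (C.edge i) e := by
    intro i e
    have h : ∃ j, C.vert j = C.vert i := ⟨i, rfl⟩
    change (if h : ∃ j, C.vert j = C.vert i then
      R.arcInd (C.vert i) (C.edge (h.choose - 1)) (C.edge h.choose) e else _) = _
    rw [dif_pos h, C.vert_injective h.choose_spec]
  have hc2 : ∀ v ∉ Set.range C.vert, ∀ e, c v e = if v ∈ R.leftSide C then 1 else 0 :=
    fun v hv e => dif_neg hv
  have hle : ∀ v e, c v e ≤ 1 := by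
    intro v e
    by_cases hv : v ∈ Set.range C.vert
    · obtain ⟨i, rfl⟩ := hv
      rw [hc1]
      exact arcInd_le_one e
    · rw [hc2 v hv]
      split_ifs <;> simp
  have hge : ∀ v e, 0 ≤ c v e := by
    intro v e
    by_cases hv : v ∈ Set.range C.vert
    · obtain ⟨i, rfl⟩ := hv
      rw [hc1]
      exact arcInd_nonneg e
    · rw [hc2 v hv]
      split_ifs <;> simp
  -- An edge off `C` leaving the left region must end in it, else a path from left to right appears.
  -- Used in both directions, this shows that such edges carry no net flow; only the edges of `C`
  -- do, one unit each in the direction of `C`.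
  have hnon : ∀ (v w : V(G)) e, G.IsLink e v w → e ∉ Set.range C.edge → c v e = 1 → c w e = 1 := by
    intro v w e hl he hv
    by_cases hwC : w ∈ Set.range C.vert
    · obtain ⟨j, rfl⟩ := hwC
      rw [hc1]
      by_contra hne
      have hright := isRightOf_of_arcInd_ne_one hne hl.inc_right fun h => he ⟨_, h.symm⟩
      by_cases hvC : v ∈ Set.range C.vert
      · obtain ⟨i, rfl⟩ := hvC
        rw [hc1] at hv
        refine hC ⟨0, fun n => if n = 0 then C.vert i else C.vert j, fun _ => e, i, j, ?_, ?_,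
          rfl, rfl, fun n h0 h1 => by omega,
          isBetween_of_arcInd_eq hv fun h => he ⟨_, h.symm⟩, hright⟩
        · intro n hn
          obtain rfl : n = 0 := by omega
          simpa using hl
        · intro m hm n hn _
          simp only [Set.mem_Iic, Nat.le_zero] at hm hn
          rw [hm, hn]
      · rw [hc2 v hvC] at hv
        by_cases h : v ∈ R.leftSide C
        · exact hC (isNonseparating_of_mem_leftSide h hl hright)
        · rw [if_neg h] at hv
          omega
    · rw [hc2 w hwC, if_pos]
      by_cases hvC : v ∈ Set.range C.vert
      · obtain ⟨i, rfl⟩ := hvC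
        rw [hc1] at hv
        exact ⟨i, e, w, isBetween_of_arcInd_eq hv fun h => he ⟨_, h.symm⟩, hl, hwC, .refl⟩
      · rw [hc2 v hvC] at hv
        have h : v ∈ R.leftSide C := by
          by_contra h
          rw [if_neg h] at hv
          omega
        obtain ⟨i, e₀, w₀, h1, h2, h3, h4⟩ := h
        exact ⟨i, e₀, w₀, h1, h2, h3, h4.tail ⟨hwC, e, hl.edge_mem, hl⟩⟩
  have hdiff : ∀ (v w : V(G)) e, G.IsLink e v w → c v e - c w e = -C.turn v e := by
    intro v w e hl
    by_cases he : e ∈ Set.range C.edge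
    · obtain ⟨k, rfl⟩ := he
      have h1 : c (C.vert k) (C.edge k) = 1 := by rw [hc1, arcInd_right]
      have h2 : c (C.vert (k + 1)) (C.edge k) = 0 := by
        have := arcInd_left (R := R) (C.inc_in (k + 1)) (C.inc_out (k + 1)) (C.in_ne_out (k + 1))
        rw [add_sub_cancel_right] at this
        rw [hc1, add_sub_cancel_right, this]
      rcases hl.vert_eq_or (C.isLink k) with ⟨rfl, rfl⟩ | ⟨rfl, rfl⟩
      · rw [h1, h2, C.turn_vert, if_neg (C.in_ne_out k).symm, if_pos rfl]
        norm_num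
      · have h3 := C.in_ne_out (k + 1)
        rw [add_sub_cancel_right] at h3
        rw [h1, h2, C.turn_vert, add_sub_cancel_right, if_pos rfl, if_neg h3]
        norm_num
    · have hturn : C.turn v e = 0 := by
        by_cases hvC : v ∈ Set.range C.vert
        · obtain ⟨i, rfl⟩ := hvC
          rw [C.turn_vert, if_neg fun h => he ⟨_, h.symm⟩, if_neg fun h => he ⟨_, h.symm⟩, sub_zero]
        · exact C.turn_of_notMem hvC e
      rw [hturn]
      have h1 := hnon v w e hl he
      have h2 := hnon w v e hl.symm he
      have := hle v e
      have := hge v e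
      have := hle w e
      have := hge w e
      omega
  refine ⟨c, fun v e he => ?_, funext fun w => ?_⟩
  · by_cases hvC : v ∈ Set.range C.vert
    · obtain ⟨i, rfl⟩ := hvC
      rw [hc1, hc1, arcInd_next (C.inc_in i) (C.inc_out i) (C.in_ne_out i), C.turn_vert]
    · rw [hc2 v hvC, hc2 v hvC, C.turn_of_notMem hvC, sub_self]
  · have h1 : G.netFlow c w = -∑ e ∈ G.incFinset w, C.turn w e := by
      rw [netFlow, ← Finset.sum_neg_distrib]
      exact Finset.sum_congr rfl fun e he => hdiff _ _ _ (mem_incFinset.1 he).isLink_tgt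
    rw [h1, Pi.zero_apply, neg_eq_zero]
    by_cases hwC : w ∈ Set.range C.vert
    · obtain ⟨i, rfl⟩ := hwC
      simp [C.turn_vert, Finset.sum_sub_distrib, mem_incFinset, C.inc_in i, C.inc_out i]
    · exact Finset.sum_eq_zero fun e _ => C.turn_of_notMem hwC e

end separating

end RibbonStructure

namespace RibbonStructure

variable {R : G.RibbonStructure}

/-! ### Paths crossing a reversible cycle -/

section crossing

variable [Fintype V(G)] [Finite E(G)] [G.Loopless]

/-- For a reversible cycle there is a conservative flow which is maximal at the out-edges and the
left edges of the cycle, but not at its in-edges and right edges. -/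
lemma IsReversible.exists_flow (hG : G.IsConnected) {C : G.OrientedCycle}
    (hC : R.IsReversible C) : ∃ (c : V(G) → β → ℤ) (M : ℤ), G.netFlow c = 0 ∧
      (∀ v, ∀ e ∈ G.incFinset v, c v e ≤ M) ∧
      (∀ v, ∀ e ∈ G.incFinset v, ∀ f ∈ G.incFinset v, c v e ≤ c v f + 1) ∧
      (∀ i e, G.Inc e (C.vert i) →
        c (C.vert i) e = M - 1 + R.arcInd (C.vert i) (C.edge (i - 1)) (C.edge i) e) ∧
      ∀ v ∉ Set.range C.vert, ∀ e f, G.Inc e v → G.Inc f v → c v e = c v f := by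
  classical
  obtain ⟨c, hc, h0⟩ := hC
  have hoff : ∀ v ∉ Set.range C.vert, ∀ e f, G.Inc e v → G.Inc f v → c v e = c v f :=
    fun v hv e f he hf =>
      eq_of_next_sub_eq_zero (R := R) (fun g hg => by rw [hc v g hg, C.turn_of_notMem hv]) hf he
  have hon : ∀ i e, G.Inc e (C.vert i) → c (C.vert i) e = c (C.vert i) (C.edge (i - 1)) +
      R.arcInd (C.vert i) (C.edge (i - 1)) (C.edge i) e := fun i e he =>
    eq_add_arcInd (C.inc_in i) (C.inc_out i) (C.in_ne_out i)
      (fun g hg => by rw [hc _ g hg, C.turn_vert]) he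
  have hon' : ∀ i e, G.Inc e (C.vert i) → c (C.vert i) e = c (C.vert i) (C.edge i) - 1 +
      R.arcInd (C.vert i) (C.edge (i - 1)) (C.edge i) e := by
    intro i e he
    have h1 := hon i e he
    have h2 := hon i _ (C.inc_out i)
    rw [arcInd_right] at h2
    omega
  have hosc : ∀ v, ∀ e ∈ G.incFinset v, ∀ f ∈ G.incFinset v, c v e ≤ c v f + 1 := by
    intro v e he f hf
    rw [mem_incFinset] at he hf
    by_cases hv : v ∈ Set.range C.vert
    · obtain ⟨i, rfl⟩ := hv
      have h1 := hon i e he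
      have h2 := hon i f hf
      have h3 := arcInd_le_one (R := R) (v := C.vert i) (a := C.edge (i - 1)) (b := C.edge i) e
      have h4 := arcInd_nonneg (R := R) (v := C.vert i) (a := C.edge (i - 1)) (b := C.edge i) f
      omega
    · rw [hoff v hv e f he hf]
      omega
  obtain ⟨⟨w, g⟩, hg, hM⟩ := Finset.exists_max_image (Finset.univ.sigma G.incFinset)
    (fun x => c x.1 x.2) ⟨⟨C.vert 0, C.edge 0⟩, by simpa [mem_incFinset] using C.inc_out 0⟩
  simp only [Finset.mem_sigma, Finset.mem_univ, true_and, mem_incFinset] at hg hM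
  have hM' : ∀ v, ∀ e ∈ G.incFinset v, c v e ≤ c w g := fun v e he =>
    hM ⟨v, e⟩ (mem_incFinset.1 he)
  have hout : ∀ i e, G.Inc e (C.vert i) → c (C.vert i) e = c w g →
      c (C.vert i) (C.edge i) = c w g := by
    intro i e he h
    have h1 := hon' i e he
    have h2 := arcInd_le_one (R := R) (v := C.vert i) (a := C.edge (i - 1)) (b := C.edge i) e
    have h3 := hM' _ _ (mem_incFinset.2 (C.inc_out i))
    omega
  -- Off `C` the flow is constant at each vertex, so one maximal dart makes all darts there maximal
  -- and maximality spreads to all neighbours. By connectedness it reaches `C`.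
  have hmeet : ∃ i, c (C.vert i) (C.edge i) = c w g := by
    have key : ∀ u, G.ReachesIn E(G) w u → (∃ i, c (C.vert i) (C.edge i) = c w g) ∨
        ∃ e, G.Inc e u ∧ c u e = c w g := by
      intro u hu
      induction hu with
      | refl => exact .inr ⟨g, hg, rfl⟩
      | @tail x y _ h ih =>
        obtain ⟨e, -, hl⟩ := h
        rcases ih with h | ⟨f, hf, hfM⟩
        · exact .inl h
        · by_cases hx : x ∈ Set.range C.vert
          · obtain ⟨i, rfl⟩ := hx
            exact .inl ⟨i, hout i f hf hfM⟩
          · refine .inr (exists_max_dart_of_max_dart h0 hM' hosc hl ?_)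
            rw [hoff x hx e f hl.inc_left hf, hfM]
    rcases key _ (hG.2 w (C.vert 0)) with h | ⟨e, he, heM⟩
    · exact h
    · exact ⟨0, hout 0 e he heM⟩
  obtain ⟨i, hi⟩ := hmeet
  -- A maximal out-edge yields a maximal dart at the next vertex of `C`, where the out-edge is then
  -- maximal as well; so maximality goes all the way round.
  have hall : ∀ k : ℕ, c (C.vert (i + k)) (C.edge (i + k)) = c w g := by
    intro k
    induction k with
    | zero => simpa using hi
    | succ k ih =>
      obtain ⟨e, he, heM⟩ := exists_max_dart_of_max_dart h0 hM' hosc (C.isLink (i + k)) ih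
      rw [Nat.cast_succ, ← add_assoc]
      exact hout _ e he heM
  refine ⟨c, c w g, h0, hM', hosc, fun j e he => ?_, hoff⟩
  have h1 := hall (j - i).val
  rw [ZMod.natCast_zmod_val, add_sub_cancel] at h1
  rw [hon' j e he, h1]

/-- No path crosses a reversible cycle from the left to the right. -/
lemma IsReversible.not_crossing (hG : G.IsConnected) {C : G.OrientedCycle}
    (hC : R.IsReversible C) {k : ℕ} (hk : 0 < k) {p : ℕ → V(G)} {f : ℕ → β} {i j : ZMod C.length}
    (hl : ∀ n ≤ k, G.IsLink (f n) (p n) (p (n + 1))) (hp : p 0 = C.vert i)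
    (hp' : p (k + 1) = C.vert j) (hoff : ∀ n, 0 < n → n ≤ k → p n ∉ Set.range C.vert)
    (hf : R.IsLeftOf C i (f 0)) (hf' : R.IsRightOf C j (f k)) : False := by
  obtain ⟨c, M, h0, hM, hosc, hon, hconst⟩ := hC.exists_flow hG
  have h1 : c (p 0) (f 0) = M := by
    rw [hp, hon i _ (hf.inc (C.inc_in i)), hf.arcInd_eq]
    ring
  have key : ∀ n, n + 1 ≤ k → ∀ e, G.Inc e (p (n + 1)) → c (p (n + 1)) e = M := by
    intro n
    induction n with
    | zero =>
      intro hn e he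
      obtain ⟨e', he', h⟩ := exists_max_dart_of_max_dart h0 hM hosc (hl 0 (by omega)) h1
      rw [← h]
      exact hconst _ (hoff 1 one_pos hn) _ _ he he'
    | succ n ih =>
      intro hn e he
      have h2 := hl (n + 1) (by omega)
      obtain ⟨e', he', h⟩ := exists_max_dart_of_max_dart h0 hM hosc h2
        (ih (by omega) _ h2.inc_left)
      rw [← h]
      exact hconst _ (hoff (n + 1 + 1) (by omega) hn) _ _ he he'
  obtain ⟨k, rfl⟩ := Nat.exists_eq_succ_of_ne_zero hk.ne'
  -- At the last interior vertex all outgoing darts are maximal, hence all incoming ones are,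
  -- including the one from `C.vert j`, which as a right edge has value `M - 1`. This is where an
  -- interior vertex is needed.
  have h2 := max_dart_in_of_forall_max_dart_out h0 hM hosc (hl (k + 1) le_rfl).symm
    (key k le_rfl)
  rw [hp', hon j _ (hf'.inc (C.inc_out j)), hf'.arcInd_eq] at h2
  omega

/-- No path crosses a reversible cycle from the right to the left. -/
lemma IsReversible.not_crossing' (hG : G.IsConnected) {C : G.OrientedCycle}
    (hC : R.IsReversible C) {k : ℕ} (hk : 0 < k) {p : ℕ → V(G)} {f : ℕ → β} {i j : ZMod C.length}
    (hl : ∀ n ≤ k, G.IsLink (f n) (p n) (p (n + 1))) (hp : p 0 = C.vert i)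
    (hp' : p (k + 1) = C.vert j) (hoff : ∀ n, 0 < n → n ≤ k → p n ∉ Set.range C.vert)
    (hf : R.IsRightOf C i (f 0)) (hf' : R.IsLeftOf C j (f k)) : False := by
  refine hC.not_crossing hG hk (p := fun n => p (k + 1 - n)) (f := fun n => f (k - n))
    (i := j) (j := i) (fun n hn => ?_) hp' (by simpa using hp)
    (fun n h0 hn => hoff _ (by omega) (by omega)) hf' (by simpa using hf)
  have := (hl (k - n) (by omega)).symm
  rw [show k - n + 1 = k + 1 - n by omega] at this
  rwa [show k + 1 - (n + 1) = k - n by omega]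

/-- If an edge joins the right side of a reversible cycle at some vertex to the left side, then
another edge joins the left side at this vertex to the right side. -/
lemma IsReversible.exists_chord (hG : G.IsConnected) {C : G.OrientedCycle}
    (hC : R.IsReversible C) {i j : ZMod C.length} {e : β} (hl : G.IsLink e (C.vert i) (C.vert j))
    (hi : R.IsRightOf C i e) (hj : R.IsLeftOf C j e) :
    ∃ h j', G.IsLink h (C.vert i) (C.vert j') ∧ R.IsLeftOf C i h ∧ R.IsRightOf C j' h := by
  obtain ⟨c, M, h0, hM, hosc, hon, hconst⟩ := hC.exists_flow hG
  have hin : ∀ i, c (C.vert i) (C.edge (i - 1)) = M - 1 := by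
    intro i
    rw [hon i _ (C.inc_in i), arcInd_left (C.inc_in i) (C.inc_out i) (C.in_ne_out i), add_zero]
  have hout : ∀ i, c (C.vert i) (C.edge i) = M := by
    intro i
    rw [hon i _ (C.inc_out i), arcInd_right]
    ring
  classical
  set A := (G.incFinset (C.vert i)).filter fun e => c (C.vert i) e = M with hA
  set B := (G.incFinset (C.vert i)).filter fun e => c (G.tgt (C.vert i) e) e = M with hB
  -- Both `e` and the in-edge of `C` are maximal only towards `C.vert i`. So at least two edges are
  -- maximal only away from it, and one of them is not the out-edge.
  have hcard : (A \ B).card = (B \ A).card :=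
    Finset.card_sdiff_comm (card_max_darts h0 hM hosc (C.vert i))
  have he : e ∈ B \ A := by
    rw [Finset.mem_sdiff, hA, hB, Finset.mem_filter, Finset.mem_filter, mem_incFinset, hl.tgt_eq,
      hon j e hl.inc_right, hj.arcInd_eq, hon i e hl.inc_left, hi.arcInd_eq]
    exact ⟨⟨hl.inc_left, by ring⟩, fun h => by omega⟩
  have he' : C.edge (i - 1) ∈ B \ A := by
    rw [Finset.mem_sdiff, hA, hB, Finset.mem_filter, Finset.mem_filter, mem_incFinset,
      (C.isLink_in i).symm.tgt_eq, hout, hin]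
    exact ⟨⟨C.inc_in i, rfl⟩, fun h => by omega⟩
  have hne : e ≠ C.edge (i - 1) := hi.ne_right
  have h1 : 1 < (A \ B).card := by
    rw [hcard]
    exact Finset.one_lt_card.2 ⟨e, he, _, he', hne⟩
  obtain ⟨h, hh, hho⟩ := Finset.exists_mem_ne h1 (C.edge i)
  rw [Finset.mem_sdiff, hA, hB, Finset.mem_filter, Finset.mem_filter, mem_incFinset] at hh
  obtain ⟨⟨hinc, hhM⟩, hhB⟩ := hh
  have hlink := hinc.isLink_tgt
  replace hhB : c (G.tgt (C.vert i) h) h ≠ M := fun h' => hhB ⟨hinc, h'⟩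
  have hleft : R.IsLeftOf C i h := by
    rw [hon i h hinc] at hhM
    exact isBetween_of_arcInd_eq (by omega) hho
  obtain ⟨f, hf, hfM⟩ := exists_max_dart_of_max_dart h0 hM hosc hlink hhM
  by_cases htC : G.tgt (C.vert i) h ∈ Set.range C.vert
  · obtain ⟨j', hj'⟩ := htC
    rw [← hj'] at hhB hlink
    refine ⟨h, j', hlink, hleft, isRightOf_of_arcInd_ne_one (fun h' => hhB ?_) hlink.inc_right ?_⟩
    · rw [hon j' h hlink.inc_right, h']
      ring
    · intro h'
      have hinc' := hinc
      rw [h'] at hinc'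
      rcases C.eq_or_eq_of_inc hinc' with h2 | h2
      · exact hho (by rw [h', h2])
      · rw [h2] at h'
        exact hleft.ne_left (C.inc_in i) (C.inc_out i) h'
  · exact absurd (by rw [hconst _ htC h f hlink.inc_right hf, hfM]) hhB

end crossing

/-! ### If all cycles are reversible, then the ribbon graph is planar -/

section planar

variable [Fintype V(G)] [Finite E(G)] [G.Loopless]

open OrientedCycle in
/-- A chord divides a cycle into two arcs. If the chord starts and ends on different sides of the
cycle, then one arc crosses the cycle formed by the chord and the other one. -/
lemma not_chord_of_two_le (hG : G.IsConnected) (hR : ∀ C, R.IsReversible C) {C : G.OrientedCycle}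
    {s t : ZMod C.length} {e : β} (hl : G.IsLink e (C.vert t) (C.vert s)) (h2 : 2 ≤ (s - t).val)
    (hside : (R.IsLeftOf C t e ∧ R.IsRightOf C s e) ∨ (R.IsRightOf C t e ∧ R.IsLeftOf C s e)) :
    False := by
  have hts : t ≠ s := by
    rintro rfl
    simp at h2
  have hsum : (s - t).val + (t - s).val = C.length := by
    have : NeZero (s - t) := ⟨sub_ne_zero.2 hts.symm⟩
    have h3 := ZMod.val_neg_of_ne_zero (s - t)
    have h4 := ZMod.val_lt (s - t)
    rw [neg_sub] at h3
    omega
  have hlt := ZMod.val_lt (s - t)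
  -- The new cycle follows the `n + 1` edges of `C` from `s` to `t` and returns by the chord. The
  -- other arc has `K + 1` edges, with `K ≥ 1` because its length is at least two; it is traversed
  -- backwards from `s` to `t`.
  obtain ⟨n, hn⟩ : ∃ n, (t - s).val = n + 1 := ⟨(t - s).val - 1, by omega⟩
  obtain ⟨K, hK⟩ : ∃ K, (s - t).val = K + 1 := ⟨(s - t).val - 1, by omega⟩
  have hnc : s + ((n + 1 : ℕ) : ZMod C.length) = t := by
    rw [← hn, ZMod.natCast_zmod_val]
    ring
  have hKc : s - ((K + 1 : ℕ) : ZMod C.length) = t := by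
    rw [← hK, ZMod.natCast_zmod_val]
    ring
  have heC : e ∉ Set.range C.edge := by
    rintro ⟨k, rfl⟩
    rcases C.eq_or_eq_of_inc hl.inc_left with rfl | rfl
    · rcases hside with ⟨h, -⟩ | ⟨h, -⟩
      · exact h.ne_right rfl
      · exact h.ne_left (C.inc_out _) (C.inc_in _) rfl
    · rcases hside with ⟨h, -⟩ | ⟨h, -⟩
      · exact h.ne_left (C.inc_in _) (C.inc_out _) rfl
      · exact h.ne_right rfl
  have hpath : G.IsPathIn E(G) (n + 1) (fun k => C.vert (s + k)) (fun k => C.edge (s + k)) :=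
    C.isPathIn s (by omega) fun k _ => (C.isLink _).edge_mem
  have hg : G.IsLink e (C.vert (s + ((n + 1 : ℕ) : ZMod C.length)))
      (C.vert (s + ((0 : ℕ) : ZMod C.length))) := by
    rw [hnc, Nat.cast_zero, add_zero]
    exact hl
  have hgf : ∀ k < n + 1, C.edge (s + k) ≠ e := fun k _ h => heC ⟨_, h⟩
  have hv0 := ofPath_vert hpath e hg hgf (Nat.zero_le _)
  have he0 := ofPath_edge hpath e hg hgf n.succ_pos
  have he0' := ofPath_edge_zero_sub hpath e hg hgf
  have hvn := ofPath_vert hpath e hg hgf le_rfl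
  have hen := ofPath_edge_last hpath e hg hgf
  have hen' := ofPath_edge_succ_sub hpath e hg hgf n.lt_succ_self
  have hoff : ∀ v ∈ Set.range (ofPath hpath e hg hgf).vert, ∃ k ≤ n + 1, v = C.vert (s + k) :=
    fun v hv => exists_eq_of_mem_range_ofPath hpath e hg hgf hv
  have hrev := hR (ofPath hpath e hg hgf)
  generalize ofPath hpath e hg hgf = C' at *
  have hs : s + ((0 : ℕ) : ZMod C.length) = s := by rw [Nat.cast_zero, add_zero]
  rw [hs] at hv0 he0
  rw [hnc] at hvn
  have hnt : s + (n : ZMod C.length) = t - 1 := by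
    rw [← hnc]
    push_cast
    ring
  rw [hnt] at hen'
  have hst : s - (K : ZMod C.length) - 1 = t := by
    rw [← hKc]
    push_cast
    ring
  have hlinks : ∀ m ≤ K, G.IsLink (C.edge (s - m - 1)) (C.vert (s - m))
      (C.vert (s - ((m + 1 : ℕ) : ZMod C.length))) := by
    intro m _
    have := (C.isLink_in (s - m)).symm
    rwa [sub_sub, ← Nat.cast_succ] at this ⊢
  have hinterior : ∀ m, 0 < m → m ≤ K → C.vert (s - m) ∉ Set.range C'.vert := by
    intro m hm hmK hmem
    obtain ⟨k, hk, hkm⟩ := hoff _ hmem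
    have h3 := C.vert_injective hkm
    have h4 : ((k + m : ℕ) : ZMod C.length) = 0 := by
      push_cast
      linear_combination -h3
    rw [ZMod.natCast_eq_zero_iff] at h4
    have := Nat.le_of_dvd (by omega) h4
    omega
  have hs0 : C.vert (s - ((0 : ℕ) : ZMod C.length)) = C'.vert ((0 : ℕ) : ZMod C'.length) := by
    rw [hv0, Nat.cast_zero, sub_zero]
  have hsK : C.vert (s - ((K + 1 : ℕ) : ZMod C.length)) =
      C'.vert ((n + 1 : ℕ) : ZMod C'.length) := by
    rw [hvn, hKc]
  have hneI := C.in_ne_out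
  rcases hside with ⟨hleft, hright⟩ | ⟨hright, hleft⟩
  · refine hrev.not_crossing hG (k := K) (by omega) (p := fun m => C.vert (s - m))
      (f := fun m => C.edge (s - m - 1)) hlinks hs0 hsK hinterior ?_ ?_
    · rw [IsLeftOf, he0, he0', hv0, Nat.cast_zero, sub_zero]
      exact IsBetween.rotate hright (C.inc_out s) (C.inc_in s) (hneI s).symm
    · rw [IsRightOf, hen, hen', hvn, hst]
      exact IsBetween.rotate hleft (C.inc_in t) (C.inc_out t) (hneI t)
  · refine hrev.not_crossing' hG (k := K) (by omega) (p := fun m => C.vert (s - m))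
      (f := fun m => C.edge (s - m - 1)) hlinks hs0 hsK hinterior ?_ ?_
    · rw [IsRightOf, he0, he0', hv0, Nat.cast_zero, sub_zero]
      exact (IsBetween.rotate hleft (C.inc_in s) (C.inc_out s) (hneI s)).rotate
        hl.inc_right (C.inc_in s) (hleft.ne_left (C.inc_in s) (C.inc_out s))
    · rw [IsLeftOf, hen, hen', hvn, hst]
      exact (IsBetween.rotate hright (C.inc_out t) (C.inc_in t) (hneI t).symm).rotate
        hl.inc_left (C.inc_out t) (hright.ne_left (C.inc_out t) (C.inc_in t))

open OrientedCycle in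
/-- Three parallel edges do not have the same cyclic order at both ends. -/
lemma not_isBetween_both_ends (hG : G.IsConnected) (hR : ∀ C, R.IsReversible C) {v w : V(G)}
    (m : ℕ) : ∀ a b e, b ≠ a → G.IsLink a v w → G.IsLink b v w → G.IsLink e v w →
      e = (R.next v ^ m) b → R.IsBetween v b e a → R.IsBetween w b e a → False := by
  induction m using Nat.strong_induction_on with
  | _ m ih =>
    intro a b e hba ha hb he hm hv hw
    -- In the cycle going along `e` from `v` to `w` and back along `b`, the edge `a` is on the right
    -- at `v` and on the left at `w`. The chord `h` obtained from it again joins `v` to `w` and lies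
    -- between `b` and `e` at both ends. At `v` it is fewer steps after `b` than `e` is, so the
    -- number `m` descends.
    have hbe : e ≠ b := hv.ne_left hb.inc_left ha.inc_left
    let p : ℕ → V(G) := fun k => if k = 0 then v else w
    have hpath : G.IsPathIn E(G) 1 p fun _ => e := by
      refine ⟨fun _ _ => he.edge_mem, fun k hk => ?_, fun k hk l hl hkl => ?_⟩
      · obtain rfl : k = 0 := by omega
        simpa [p] using he
      · simp only [Set.mem_Iic] at hk hl
        by_contra hne
        rcases (show k = 0 ∧ l = 1 ∨ k = 1 ∧ l = 0 by omega) with ⟨rfl, rfl⟩ | ⟨rfl, rfl⟩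
        · exact he.vert_ne (by simpa [p] using hkl)
        · exact he.vert_ne (by simpa [p] using hkl.symm)
    have hg : G.IsLink b (p 1) (p 0) := hb.symm
    have hgf : ∀ k < 1, (fun _ => e) k ≠ b := fun _ _ => hbe
    have hv0 := ofPath_vert hpath b hg hgf (Nat.zero_le _)
    have he0 := ofPath_edge hpath b hg hgf one_pos
    have he0' := ofPath_edge_zero_sub hpath b hg hgf
    have hv1 := ofPath_vert hpath b hg hgf le_rfl
    have he1 := ofPath_edge_last hpath b hg hgf
    have he1' := ofPath_edge_succ_sub hpath b hg hgf one_pos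
    have hC : ∀ i : ZMod (ofPath hpath b hg hgf).length, i = ((0 : ℕ) : ZMod _) ∨
        i = ((1 : ℕ) : ZMod _) := by
      intro i
      have hi : ZMod.val (n := 2) i < 2 := ZMod.val_lt (n := 2) i
      have hi' : ((ZMod.val i : ℕ) : ZMod (ofPath hpath b hg hgf).length) = i :=
        ZMod.natCast_zmod_val i
      rw [← hi']
      rcases (show ZMod.val (n := 2) i = 0 ∨ ZMod.val (n := 2) i = 1 by omega) with h | h
      · exact .inl (congrArg _ h)
      · exact .inr (congrArg _ h)
    have hrev := hR (ofPath hpath b hg hgf)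
    generalize ofPath hpath b hg hgf = C' at *
    replace hv0 : C'.vert ((0 : ℕ) : ZMod _) = v := hv0
    replace hv1 : C'.vert ((1 : ℕ) : ZMod _) = w := hv1
    rw [zero_add] at he1'
    obtain ⟨h, j', hh, hleft, hright⟩ := hrev.exists_chord hG (i := ((0 : ℕ) : ZMod _))
      (j := ((1 : ℕ) : ZMod _)) (e := a) (by rwa [hv0, hv1])
      (by
        rw [IsRightOf, hv0, he0, he0']
        exact hv.rotate hb.inc_left ha.inc_left hba)
      (by
        rw [IsLeftOf, hv1, he1, he1']
        exact hw.rotate hb.inc_right ha.inc_right hba)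
    rw [hv0] at hh
    rcases hC j' with rfl | rfl
    · rw [hv0] at hh
      exact hh.vert_ne rfl
    · rw [hv1] at hh
      rw [IsLeftOf, hv0, he0, he0'] at hleft
      rw [IsRightOf, hv1, he1, he1'] at hright
      obtain ⟨m', hm', h1, h2⟩ := id hleft
      refine ih m' ?_ e b h hbe.symm he hb hh h1 hleft hright
      by_contra hlt
      refine h2 m (Nat.pos_of_ne_zero ?_) (by omega) hm.symm
      rintro rfl
      exact hbe hm

lemma isPlanar_of_isReversible (hG : G.IsConnected) (hR : ∀ C, R.IsReversible C) :
    R.IsPlanar := by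
  rintro C ⟨k, p, f, i, j, hl, -, hp, hp', hoff, hf, hf'⟩
  rcases Nat.eq_zero_or_pos k with rfl | hk
  · have hij := hl 0 le_rfl
    rw [hp, hp'] at hij
    by_cases h1 : 2 ≤ (j - i).val
    · exact not_chord_of_two_le hG hR hij h1 (.inl ⟨hf, hf'⟩)
    by_cases h2 : 2 ≤ (i - j).val
    · exact not_chord_of_two_le hG hR hij.symm h2 (.inr ⟨hf', hf⟩)
    have hne : i ≠ j := by
      rintro rfl
      exact hij.vert_ne rfl
    have h3 : (j - i).val ≠ 0 := fun h => hne (sub_eq_zero.1 ((ZMod.val_eq_zero _).1 h)).symm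
    have h4 : (i - j).val ≠ 0 := fun h => hne (sub_eq_zero.1 ((ZMod.val_eq_zero _).1 h))
    -- Both arcs have length one, so `C` is a pair of parallel edges and the chord is a third one.
    have hj : j = i + 1 := by
      have h5 := ZMod.natCast_zmod_val (j - i)
      rw [show (j - i).val = 1 by omega, Nat.cast_one] at h5
      rw [h5, add_sub_cancel]
    have hi : i = j + 1 := by
      have h5 := ZMod.natCast_zmod_val (i - j)
      rw [show (i - j).val = 1 by omega, Nat.cast_one] at h5
      rw [h5, add_sub_cancel]
    have hi' : i - 1 = j := sub_eq_of_eq_add hi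
    have hj' : j - 1 = i := sub_eq_of_eq_add hj
    rw [IsLeftOf, hi'] at hf
    rw [IsRightOf, hj'] at hf'
    have ha := C.isLink i
    rw [← hj] at ha
    have hb := (C.isLink j).symm
    rw [← hi] at hb
    obtain ⟨m, -, hm, -⟩ := id hf
    exact not_isBetween_both_ends hG hR m _ _ _
      (fun h => hne (C.edge_injective h).symm) ha hb hij hm hf hf'
  · exact (hR C).not_crossing hG hk hl hp hp' hoff hf hf'

end planar

end RibbonStructure

end

end Graph


theorem theorem1 {α β : Type*} (G : Graph α β) [Fintype V(G)] [Finite E(G)] [G.Loopless]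
    (hG : G.IsConnected) (R : G.RibbonStructure) :
    ∃ φ : V(G) → (Multiplicative G.PicZero →* Equiv.Perm G.SpanningTree),
      (∀ (r : V(G)) (ψ : Multiplicative G.PicZero →* Equiv.Perm G.SpanningTree),
        R.IsRotorRoutingAction r ψ ↔ ψ = φ r) ∧
      ((∀ r s : V(G), φ r = φ s) ↔ R.IsPlanar) :=
  ⟨R.routingAction hG, R.isRotorRoutingAction_iff hG,
    fun h => Graph.RibbonStructure.isPlanar_of_isReversible hG
      (Graph.RibbonStructure.isReversible_of_routingAction_eq hG h),
    fun h => Graph.RibbonStructure.routingAction_eq_of_isReversible hG fun C =>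
      Graph.RibbonStructure.isReversible_of_not_isNonseparating (h C)⟩
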